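/- Let $d, M, N \in \mathbb{N} = \{0, 1, 2, \ldots\}$ and $t > 0$. For $Q \in \mathbb{R}^{d+1}\setminus\{0\}$ put $\mathcal{R}_Q P := 2|Q|^{-2}(Q\cdot P)Q - P$ (the reflection in the line spanned by $Q$), and $\mathcal{R}_0 P := -P$. Let $p : (0,\infty)\times\mathbb{S}^d\times\mathbb{S}^d \to [0,\infty)$ be the heat kernel of the unit sphere $\mathbb{S}^d \subset \mathbb{R}^{d+1}$, normalised so that $f(t,y) = p(t,x,y)$ solves $\partial_t f = \frac12 \Delta f$, where $\Delta$ is the Laplace--Beltrami operator, and converges to the Dirac mass at $x$ as $t \to 0^+$. For $K \in \mathbb{N}$, a random sequence $(X(0), \ldots, X(K))$ in $\mathbb{S}^d$ is called a heat Markov chain with parameter $t$ if its law has the density $|\mathbb{S}^d|^{-1}\prod_{k=0}^{K-1} p(t, X(k), X(k+1))$ with respect to the $(K+1)$-fold product of the surface measure of $\mathbb{S}^d$. Let $(Y_+(m))_{0\le m\le M}$ and $(Y_-(n))_{0\le n\le N}$ be random sequences in $\mathbb{S}^d$, defined on one probability space, such that $Y_+(0) = Y_-(0)$ with probability $1$ and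 $$\big(Y_-(N), Y_-(N-1), \ldots, Y_-(1), Y_-(0) = Y_+(0), Y_+(1), \ldots, Y_+(M)\big)$$ is a heat Markov chain with parameter $t$. Let $(Y(m,n))_{0\le m\le M,\,0\le n\le N}$ be the $\mathbb{S}^d$-valued random field which with probability $1$ solves the discrete wave maps equation with boundary data $Y_\pm$: $$Y(m,0) = Y_+(m), \quad Y(0,n) = Y_-(n), \quad Y(m+1,n+1) = \mathcal{R}_{Y(m+1,n)+Y(m,n+1)}Y(m,n).$$ 1. If $(m_j,n_j)_{j=0}^{M+N}$ is a sequence with $(m_0,n_0) = (0,N)$ and $(m_{M+N},n_{M+N}) = (M,0)$ such that, for every $0 \le j < M+N$, either $(m_{j+1},n_{j+1}) = (m_j+1,n_j)$ or $(m_{j+1},n_{j+1}) = (m_j,n_j-1)$, then the random sequence $(Y(m_j,n_j))_{j=0}^{M+N}$ is a heat Markov chain with parameter $t$. 2. Consequently the law of the field is invariant under lattice translations: if $J \in \mathbb{N}$, $(\mu,\nu) \in \{0,\ldots,M\}\times\{0,\ldots,N\}$ and $(m_j,n_j) \in \{0,\ldots,M-\mu\}\times\{0,\ldots,N-\nu\}$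 for $1 \le j \le J$, then the random vectors $(Y(m_j,n_j))_{j=1}^J$ and $(Y(\mu+m_j,\nu+n_j))_{j=1}^J$ have the same distribution. -/

import Mathlib

open MeasureTheory ProbabilityTheory Filter Topology

/-- The `(d+1)`-dimensional Euclidean space in which the sphere `S^d` lives. -/
abbrev AmbientSpace (d : ℕ) : Type := EuclideanSpace ℝ (Fin (d + 1))

/-- The unit sphere `S^d` of `ℝ^(d+1)`. -/
abbrev UnitSphere (d : ℕ) : Type := Metric.sphere (0 : AmbientSpace d) 1

/-- The surface measure of `S^d` (not normalised): the measure of `A` is `d + 1` times the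
Lebesgue measure of the cone `{r • a | 0 < r < 1, a ∈ A}`. -/
noncomputable def surfaceMeasure (d : ℕ) : Measure (UnitSphere d) :=
  (volume : Measure (AmbientSpace d)).toSphere

instance (d : ℕ) : IsFiniteMeasure (surfaceMeasure d) := by
  unfold surfaceMeasure; infer_instance

/-- The central projection `x ↦ x / |x|` of `ℝ^(d+1) ∖ {0}` onto the sphere. -/
noncomputable def centralProjection {d : ℕ} (x : AmbientSpace d) (hx : x ≠ 0) : UnitSphere d :=
  ⟨‖x‖⁻¹ • x, by simp [norm_smul, hx]⟩

open Classical in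
/-- The extension of a function on the sphere which is constant along rays, `x ↦ f (x / |x|)`
(with the value `0` at the origin). -/
noncomputable def radialExtension {d : ℕ} (f : UnitSphere d → ℝ) (x : AmbientSpace d) : ℝ :=
  if hx : x = 0 then 0 else f (centralProjection x hx)

/-- The Laplace-Beltrami operator of the round sphere: the restriction to the sphere of the
Euclidean Laplacian of the extension `x ↦ f (x / |x|)`. -/
noncomputable def sphereLaplacian {d : ℕ} (f : UnitSphere d → ℝ) (x : UnitSphere d) : ℝ :=
  Laplacian.laplacian (radialExtension f) (x : AmbientSpace d)

open scoped Manifold ContDiff in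
/-- `p` is a heat kernel of `S^d`, for the generator `Δ / 2`: a smooth nonnegative function on
`(0, ∞) × S^d × S^d` such that `(t, y) ↦ p t x y` solves `∂ₜ f = (1/2) Δ f` and tends to the Dirac
mass at `x` as `t → 0+`. Only the values for `t > 0` matter. -/
structure IsSphereHeatKernel (d : ℕ) (p : ℝ → UnitSphere d → UnitSphere d → ℝ) : Prop where
  smooth : ContMDiffOn (𝓘(ℝ, ℝ).prod ((𝓡 d).prod (𝓡 d))) 𝓘(ℝ, ℝ) ∞
    (fun q : ℝ × UnitSphere d × UnitSphere d => p q.1 q.2.1 q.2.2) (Set.Ioi 0 ×ˢ Set.univ)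
  nonneg : ∀ t : ℝ, 0 < t → ∀ x y : UnitSphere d, 0 ≤ p t x y
  heat_equation : ∀ t : ℝ, 0 < t → ∀ x y : UnitSphere d,
    HasDerivAt (fun s => p s x y) ((1 / 2) * sphereLaplacian (p t x) y) t
  initial : ∀ (x : UnitSphere d) (φ : C(UnitSphere d, ℝ)),
    Tendsto (fun t => ∫ y, p t x y * φ y ∂(surfaceMeasure d)) (𝓝[>] 0) (𝓝 (φ x))

open Classical in
/-- The heat kernel of `S^d`: the function with the defining properties `IsSphereHeatKernel`
(these determine it for `t > 0`). -/
noncomputable def sphereHeatKernel (d : ℕ) : ℝ → UnitSphere d → UnitSphere d → ℝ :=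
  if h : ∃ p, IsSphereHeatKernel d p then h.choose else 0

/-- The random sequence `X 0, …, X N` in `S^d` is a heat Markov chain with parameter `t`: the law of
`(X 0, …, X N)` has the density `|S^d|⁻¹ ∏_{n < N} p(t, x n, x (n+1))` with respect to the product
of the surface measures. -/
def IsHeatMarkovChain {Ω : Type*} [MeasurableSpace Ω] (P : Measure Ω) {d N : ℕ} (t : ℝ)
    (X : Ω → Fin (N + 1) → UnitSphere d) : Prop :=
  HasLaw X
    ((Measure.pi fun _ : Fin (N + 1) => surfaceMeasure d).withDensity fun x =>
      ENNReal.ofReal (((surfaceMeasure d).real Set.univ)⁻¹ *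
        ∏ n : Fin N, sphereHeatKernel d t (x n.castSucc) (x n.succ)))
    P

/-- The reflection `R_Q` of `ℝ^(d+1)` in the line spanned by `Q`, where `R_0 = -id`. -/
noncomputable def lineReflection {d : ℕ} (Q : AmbientSpace d) :
    AmbientSpace d ≃ₗᵢ[ℝ] AmbientSpace d :=
  (Submodule.span ℝ {Q}).reflection

/-- The formula for `R_Q P`; it gives `R_0 P = -P` because `0⁻¹ = 0`. -/
theorem lineReflection_apply {d : ℕ} (Q P : AmbientSpace d) :
    lineReflection Q P = (2 * (‖Q‖ ^ 2)⁻¹ * inner ℝ Q P) • Q - P := by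
  rw [lineReflection, Submodule.reflection_apply, Submodule.starProjection_singleton, two_smul,
    ← two_smul ℝ, smul_smul]
  congr 2
  simp [div_eq_mul_inv]
  ring

theorem lineReflection_zero {d : ℕ} (P : AmbientSpace d) :
    lineReflection (0 : AmbientSpace d) P = -P := by
  simp [lineReflection_apply]

/-- `Y` is a discrete wave map on `{0, …, M} × {0, …, N}` with boundary data `Yp` on the
horizontal side `n = 0` and `Ym` on the vertical side `m = 0`. -/
structure IsDiscreteWaveMap {d M N : ℕ} (Yp : Fin (M + 1) → UnitSphere d)
    (Ym : Fin (N + 1) → UnitSphere d) (Y : Fin (M + 1) → Fin (N + 1) → UnitSphere d) : Prop where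
  boundary_plus : ∀ m, Y m 0 = Yp m
  boundary_minus : ∀ n, Y 0 n = Ym n
  equation : ∀ (m : Fin M) (n : Fin N),
    (Y m.succ n.succ : AmbientSpace d) =
      lineReflection ((Y m.succ n.castSucc : AmbientSpace d) + (Y m.castSucc n.succ : AmbientSpace d))
        (Y m.castSucc n.castSucc)

/-- The concatenated boundary sequence `(Ym N, …, Ym 1, Ym 0, Yp 1, …, Yp M)`. -/
def boundarySequence {d M N : ℕ} (Yp : Fin (M + 1) → UnitSphere d)
    (Ym : Fin (N + 1) → UnitSphere d) (j : Fin (M + N + 1)) : UnitSphere d :=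
  if (j : ℕ) ≤ N then Ym ⟨N - j, by omega⟩ else Yp ⟨j - N, by omega⟩

/-- `(m j, n j)`, `0 ≤ j ≤ M + N`, is a lattice path from `(0, N)` to `(M, 0)` each of whose steps
goes one unit to the right or one unit down. -/
structure IsDownRightPath {M N : ℕ} (m : Fin (M + N + 1) → Fin (M + 1))
    (n : Fin (M + N + 1) → Fin (N + 1)) : Prop where
  start : m 0 = 0 ∧ n 0 = Fin.last N
  finish : m (Fin.last (M + N)) = Fin.last M ∧ n (Fin.last (M + N)) = 0
  step : ∀ j : Fin (M + N),
    ((m j.succ : ℕ) = m j.castSucc + 1 ∧ n j.succ = n j.castSucc) ∨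
    (m j.succ = m j.castSucc ∧ (n j.succ : ℕ) + 1 = n j.castSucc)

/-! The law of the chain is invariant under a local move: for consecutive points `a, x, b`, replace
`x` by its image `x'` under the reflection in the line through `a + b`. That reflection is an
isometry exchanging `a` and `b`, so symmetry and isometry invariance of the heat kernel give p(a,
x') = p(x, b) and p(x', b) = p(a, x): two factors of the density trade places. For fixed neighbours
the reflection preserves surface measure, so the law is unchanged (`map_flipAt_chainMeasure`). The
wave maps equation says that this move turns the field along (m, n+1), (m, n), (m+1, n) into the
field along (m, n+1), (m+1, n+1), (m+1, n). Every down-right path arises from the boundary path by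
such moves, which gives the first claim (`isHeatMarkovChain_fieldAt`).

For the second claim, the lower-left boundary of a translated rectangle is a block of consecutive
points of some down-right path, blocks of chains are chains, and the field in the rectangle is a
fixed measurable function of these boundary values (`eq_waveField`).

The kernel facts follow from the defining properties. For heat kernels p and q, the integral of
p_s(x, z) q_{t-s}(y, z) over z is constant in s by Green's identity, and its limits at both ends
give p_t(x, y) = q_t(y, x) (`IsSphereHeatKernel.eq_swap`). Applied to a kernel and its transport by
an isometry, this yields symmetry and invariance at once. Green's identity is pulled down from
Euclidean space by extending functions constantly along rays and cutting off radially. -/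

/-! ### The Euclidean Laplacian: product rule, linear substitutions, Green's identity. -/

section Laplacian

open Laplacian
open scoped ContDiff

variable {E : Type*} [NormedAddCommGroup E] [InnerProductSpace ℝ E]

theorem ContDiffAt.differentiableAt_fderiv {f : E → ℝ} {x : E} (hf : ContDiffAt ℝ 2 f x) :
    DifferentiableAt ℝ (fderiv ℝ f) x :=
  (hf.fderiv_right (m := 1) (by norm_num)).differentiableAt (by norm_num)

theorem ContDiffAt.eventually_differentiableAt {f : E → ℝ} {x : E} (hf : ContDiffAt ℝ 2 f x) :
    ∀ᶠ y in 𝓝 x, DifferentiableAt ℝ f y :=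
  (hf.eventually (by simp)).mono fun _ hy => hy.differentiableAt (by norm_num)

variable [FiniteDimensional ℝ E]

theorem laplacian_eq_sum_fderiv_fderiv {ι : Type*} [Fintype ι] (b : OrthonormalBasis ι ℝ E)
    (f : E → ℝ) (x : E) :
    Δ f x = ∑ i, fderiv ℝ (fderiv ℝ f) x (b i) (b i) := by
  simp [InnerProductSpace.laplacian_eq_iteratedFDeriv_orthonormalBasis f b,
    iteratedFDeriv_two_apply]

theorem laplacian_mul_eq {ι : Type*} [Fintype ι] (b : OrthonormalBasis ι ℝ E) {f g : E → ℝ} {x : E}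
    (hf : ContDiffAt ℝ 2 f x) (hg : ContDiffAt ℝ 2 g x) :
    Δ (fun y => f y * g y) x =
      f x * Δ g x + 2 * ∑ i, fderiv ℝ f x (b i) * fderiv ℝ g x (b i) + g x * Δ f x := by
  have hfd := hf.differentiableAt (by norm_num)
  have hgd := hg.differentiableAt (by norm_num)
  have h1 : fderiv ℝ (fun y => f y * g y) =ᶠ[𝓝 x]
      fun y => f y • fderiv ℝ g y + g y • fderiv ℝ f y := by
    filter_upwards [hf.eventually_differentiableAt, hg.eventually_differentiableAt] with y h h'
    exact fderiv_fun_mul h h'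
  have h2 : ∀ v, fderiv ℝ (fderiv ℝ (fun y => f y * g y)) x v v =
      f x * fderiv ℝ (fderiv ℝ g) x v v + 2 * (fderiv ℝ f x v * fderiv ℝ g x v)
        + g x * fderiv ℝ (fderiv ℝ f) x v v := by
    intro v
    rw [h1.fderiv_eq, fderiv_fun_add (hfd.fun_smul hg.differentiableAt_fderiv)
      (hgd.fun_smul hf.differentiableAt_fderiv), fderiv_fun_smul hfd hg.differentiableAt_fderiv,
      fderiv_fun_smul hgd hf.differentiableAt_fderiv]
    simp
    ring
  simp only [laplacian_eq_sum_fderiv_fderiv b, h2, Finset.sum_add_distrib, Finset.mul_sum]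

theorem laplacian_comp_continuousLinearMap {ι : Type*} [Fintype ι] (b : OrthonormalBasis ι ℝ E)
    {f : E → ℝ} {x : E} (A : E →L[ℝ] E) (hf : ContDiffAt ℝ 2 f (A x)) :
    Δ (fun y => f (A y)) x = ∑ i, fderiv ℝ (fderiv ℝ f) (A x) (A (b i)) (A (b i)) := by
  have h1 : fderiv ℝ (fun y => f (A y)) =ᶠ[𝓝 x] fun y => (fderiv ℝ f (A y)).comp A := by
    filter_upwards [A.continuous.continuousAt.eventually hf.eventually_differentiableAt] with y h
    rw [show (fun y => f (A y)) = f ∘ A from rfl, fderiv_comp y h A.differentiableAt, A.fderiv]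
  have h2 : ∀ v, fderiv ℝ (fderiv ℝ (fun y => f (A y))) x v v =
      fderiv ℝ (fderiv ℝ f) (A x) (A v) (A v) := by
    intro v
    have h3 : HasFDerivAt (fun y => fderiv ℝ f (A y))
        ((fderiv ℝ (fderiv ℝ f) (A x)).comp A) x :=
      hf.differentiableAt_fderiv.hasFDerivAt.comp x A.hasFDerivAt
    rw [h1.fderiv_eq, (h3.clm_comp (hasFDerivAt_const A x)).fderiv]
    simp
  simp only [laplacian_eq_sum_fderiv_fderiv b, h2]

theorem laplacian_comp_linearIsometryEquiv {f : E → ℝ} {x : E} (U : E ≃ₗᵢ[ℝ] E)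
    (hf : ContDiffAt ℝ 2 f (U x)) : Δ (fun y => f (U y)) x = Δ f (U x) := by
  rw [laplacian_eq_sum_fderiv_fderiv ((stdOrthonormalBasis ℝ E).map U) f]
  simpa using laplacian_comp_continuousLinearMap (stdOrthonormalBasis ℝ E)
    (U.toContinuousLinearEquiv : E →L[ℝ] E) hf

theorem laplacian_comp_smul {f : E → ℝ} {x : E} (c : ℝ) (hf : ContDiffAt ℝ 2 f (c • x)) :
    Δ (fun y => f (c • y)) x = c ^ 2 * Δ f (c • x) := by
  have := laplacian_comp_continuousLinearMap (stdOrthonormalBasis ℝ E) (x := x)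
    (c • ContinuousLinearMap.id ℝ E) (by simpa using hf)
  rw [laplacian_eq_sum_fderiv_fderiv (stdOrthonormalBasis ℝ E) f, Finset.mul_sum]
  simpa [sq, mul_assoc] using this

theorem integral_mul_laplacian_sub_eq_zero [MeasurableSpace E] [BorelSpace E]
    {f g : E → ℝ} (hf : ContDiff ℝ ∞ f) (hf' : HasCompactSupport f)
    (hg : ContDiff ℝ ∞ g) (hg' : HasCompactSupport g) :
    ∫ x, (f x * Δ g x - Δ f x * g x) = 0 := by
  set u := hf'.toSchwartzMap hf
  set v := hg'.toSchwartzMap hg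
  have hu : ∀ x, (Δ u) x = Δ f x := fun x => SchwartzMap.laplacian_apply u x
  have hv : ∀ x, (Δ v) x = Δ g x := fun x => SchwartzMap.laplacian_apply v x
  have h := SchwartzMap.integral_mul_laplacian_right_eq_left (μ := volume) u v
  have i1 := (SchwartzMap.pairing (ContinuousLinearMap.mul ℝ ℝ) u (Δ v)).integrable (μ := volume)
  have i2 := (SchwartzMap.pairing (ContinuousLinearMap.mul ℝ ℝ) (Δ u) v).integrable (μ := volume)
  replace i1 : Integrable fun x => f x * Δ g x := i1.congr (.of_forall fun x => by
    simp [SchwartzMap.pairing_apply_apply, hv, u])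
  replace i2 : Integrable fun x => Δ f x * g x := i2.congr (.of_forall fun x => by
    simp [SchwartzMap.pairing_apply_apply, hu, v])
  simp only [hu, hv] at h
  exact (integral_sub i1 i2).trans (sub_eq_zero.2 h)

end Laplacian

/-! ### Smooth functions on the sphere as functions constant along rays. -/

section RadialExtension

open scoped Manifold ContDiff
open Laplacian

variable {d : ℕ}

theorem two_le_smooth : (2 : WithTop ℕ∞) ≤ ∞ := WithTop.coe_le_coe.2 (le_top : (2 : ℕ∞) ≤ ⊤)

/-- The north pole, a base point of the sphere. -/
noncomputable def northPole (d : ℕ) : UnitSphere d :=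
  ⟨EuclideanSpace.single 0 1, by simp⟩

open Classical in
/-- The central projection, extended to the origin by the north pole. -/
noncomputable def totalProjection {d : ℕ} (x : AmbientSpace d) : UnitSphere d :=
  if hx : x = 0 then northPole d else centralProjection x hx

theorem coe_totalProjection {x : AmbientSpace d} (hx : x ≠ 0) :
    (totalProjection x : AmbientSpace d) = ‖x‖⁻¹ • x := by
  simp [totalProjection, hx, centralProjection]

theorem radialExtension_eq (f : UnitSphere d → ℝ) {x : AmbientSpace d} (hx : x ≠ 0) :
    radialExtension f x = f (totalProjection x) := by
  simp [totalProjection, hx, radialExtension]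

theorem unitSphere_ne_zero (x : UnitSphere d) : (x : AmbientSpace d) ≠ 0 :=
  ne_zero_of_mem_unit_sphere x

@[simp] theorem totalProjection_coe (x : UnitSphere d) :
    totalProjection (x : AmbientSpace d) = x := by
  ext1
  simp [coe_totalProjection (unitSphere_ne_zero x)]

theorem totalProjection_smul {c : ℝ} (hc : 0 < c) (x : AmbientSpace d) :
    totalProjection (c • x) = totalProjection x := by
  by_cases hx : x = 0
  · simp [hx]
  · ext1
    rw [coe_totalProjection hx, coe_totalProjection (smul_ne_zero hc.ne' hx), norm_smul, smul_smul,
      Real.norm_of_nonneg hc.le]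
    congr 1
    field_simp

theorem radialExtension_smul (f : UnitSphere d → ℝ) {c : ℝ} (hc : 0 < c) (x : AmbientSpace d) :
    radialExtension f (c • x) = radialExtension f x := by
  by_cases hx : x = 0
  · simp [hx]
  · rw [radialExtension_eq f hx, radialExtension_eq f (smul_ne_zero hc.ne' hx),
      totalProjection_smul hc]

theorem contMDiffAt_totalProjection {x : AmbientSpace d} (hx : x ≠ 0) :
    ContMDiffAt 𝓘(ℝ, AmbientSpace d) (𝓡 d) ∞ (totalProjection (d := d)) x := by
  have := Fact.mk (finrank_euclideanSpace_fin (𝕜 := ℝ) (n := d + 1))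
  let U : TopologicalSpace.Opens (AmbientSpace d) := ⟨{0}ᶜ, isOpen_compl_singleton⟩
  have hU : ∀ y : U, (y : AmbientSpace d) ≠ 0 := fun y => y.2
  have h1 : ContMDiff 𝓘(ℝ, AmbientSpace d) 𝓘(ℝ, AmbientSpace d) ∞
      (fun y : U => ‖(y : AmbientSpace d)‖⁻¹ • (y : AmbientSpace d)) := by
    intro y
    refine contMDiffAt_subtype_iff (U := U)
      (f := fun y : AmbientSpace d => ‖y‖⁻¹ • y).2 (ContDiffAt.contMDiffAt ?_)
    exact ((contDiffAt_norm ℝ (hU y)).inv (norm_ne_zero_iff.2 (hU y))).smul contDiffAt_id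
  have h2 := ContMDiff.codRestrict_sphere (n := d) h1
    (fun y => by simp [norm_smul, hU y])
  refine (contMDiffAt_subtype_iff (U := U) (x := ⟨x, hx⟩)).1 ?_
  exact (h2 ⟨x, hx⟩).congr_of_eventuallyEq
    (.of_forall fun y => Subtype.ext (coe_totalProjection (hU y)))

theorem contDiffAt_radialExtension {f : UnitSphere d → ℝ} (hf : ContMDiff (𝓡 d) 𝓘(ℝ, ℝ) ∞ f)
    {x : AmbientSpace d} (hx : x ≠ 0) : ContDiffAt ℝ ∞ (radialExtension f) x := by
  have h : ContDiffAt ℝ ∞ (fun y => f (totalProjection y)) x :=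
    (hf.contMDiffAt.comp x (contMDiffAt_totalProjection hx)).contDiffAt
  refine h.congr_of_eventuallyEq ?_
  filter_upwards [isOpen_ne.mem_nhds hx] with y hy using radialExtension_eq f hy

/-- The Laplacian of a function homogeneous of degree 0 is homogeneous of degree -2. -/
theorem laplacian_radialExtension {f : UnitSphere d → ℝ} (hf : ContMDiff (𝓡 d) 𝓘(ℝ, ℝ) ∞ f)
    {x : AmbientSpace d} (hx : x ≠ 0) :
    Δ (radialExtension f) x = (‖x‖ ^ 2)⁻¹ * sphereLaplacian f (totalProjection x) := by
  have hn : 0 < ‖x‖ := norm_pos_iff.2 hx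
  have h := laplacian_comp_smul (x := x) ‖x‖⁻¹ (f := radialExtension f)
    ((contDiffAt_radialExtension hf (smul_ne_zero (inv_ne_zero hn.ne') hx)).of_le two_le_smooth)
  simp only [radialExtension_smul f (inv_pos.2 hn)] at h
  rw [sphereLaplacian, coe_totalProjection hx, ← inv_pow]
  exact h

/-- Euler's relation in degree 0; it removes the cross term when a radial cutoff is multiplied in.
-/
theorem fderiv_radialExtension_self {f : UnitSphere d → ℝ} (hf : ContMDiff (𝓡 d) 𝓘(ℝ, ℝ) ∞ f)
    {x : AmbientSpace d} (hx : x ≠ 0) : fderiv ℝ (radialExtension f) x x = 0 := by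
  have h1 : HasFDerivAt (radialExtension f) (fderiv ℝ (radialExtension f) x) ((1 : ℝ) • x) := by
    rw [one_smul]
    exact ((contDiffAt_radialExtension hf hx).differentiableAt (by simp)).hasFDerivAt
  have h2 : HasDerivAt (fun c : ℝ => c • x) x 1 := by
    simpa using (hasDerivAt_id (1 : ℝ)).smul_const x
  have h3 := h1.comp_hasDerivAt (1 : ℝ) h2
  have h4 : HasDerivAt (radialExtension f ∘ fun c : ℝ => c • x) 0 1 := by
    refine (hasDerivAt_const (1 : ℝ) (radialExtension f x)).congr_of_eventuallyEq ?_
    filter_upwards [lt_mem_nhds (zero_lt_one' ℝ)] with c hc using radialExtension_smul f hc x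
  exact h3.unique h4

theorem totalProjection_linearIsometryEquiv (U : AmbientSpace d ≃ₗᵢ[ℝ] AmbientSpace d)
    {x : AmbientSpace d} (hx : x ≠ 0) :
    (totalProjection (U x) : AmbientSpace d) = U (totalProjection x) := by
  rw [coe_totalProjection hx, coe_totalProjection (by simpa using hx)]
  simp

end RadialExtension

/-! ### Polar coordinates. -/

section Polar

variable {d : ℕ}

theorem integral_radial_mul (A : ℝ → ℝ) (h : UnitSphere d → ℝ) :
    ∫ x : AmbientSpace d, A ‖x‖ * h (totalProjection x) =
      (∫ x, h x ∂(surfaceMeasure d)) *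
        ∫ r : Set.Ioi (0 : ℝ), A r ∂(Measure.volumeIoiPow (Module.finrank ℝ (AmbientSpace d) - 1)) := by
  calc
    _ = ∫ x : ({(0)}ᶜ : Set (AmbientSpace d)), A ‖x.1‖ * h (totalProjection x.1)
        ∂((volume : Measure (AmbientSpace d)).comap (↑)) := by
      rw [integral_subtype_comap (measurableSet_singleton _).compl
        fun x ↦ A ‖x‖ * h (totalProjection x), restrict_compl_singleton]
    _ = ∫ x : UnitSphere d × Set.Ioi (0 : ℝ), h x.1 * A x.2 ∂(surfaceMeasure d).prod
        (.volumeIoiPow (Module.finrank ℝ (AmbientSpace d) - 1)) := by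
      rw [surfaceMeasure, ← (volume : Measure (AmbientSpace d)).measurePreserving_homeomorphUnitSphereProd.integral_comp
        (Homeomorph.measurableEmbedding _)]
      refine integral_congr_ae (.of_forall fun x => ?_)
      have hx : (x : AmbientSpace d) ≠ 0 := x.2
      simp only [homeomorphUnitSphereProd_apply_snd_coe]
      rw [mul_comm]
      congr 2
      ext1
      rw [coe_totalProjection hx]
      simp
    _ = _ := integral_prod_mul h fun r : Set.Ioi (0 : ℝ) => A r

end Polar

/-! ### Green's identity on the sphere. -/

section Green

open scoped Manifold ContDiff
open Laplacian

/-- A bump function on the line around `1`, used to build radial cutoffs. -/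
noncomputable def radialBump : ContDiffBump (1 : ℝ) := ⟨1 / 4, 1 / 2, by norm_num, by norm_num⟩

/-- A radial cutoff supported in an annulus around the unit sphere. -/
noncomputable def radialCutoff {d : ℕ} (x : AmbientSpace d) : ℝ := radialBump (‖x‖ ^ 2)

variable {d : ℕ}

theorem contDiff_radialCutoff : ContDiff ℝ ∞ (radialCutoff (d := d)) :=
  radialBump.contDiff.comp (contDiff_norm_sq ℝ)

theorem radialBump_eq_zero {r : ℝ} (h : r ≤ 1 / 2 ∨ 3 / 2 ≤ r) : radialBump r = 0 := by
  refine radialBump.zero_of_le_dist ?_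
  rw [Real.dist_eq]
  change 1 / 2 ≤ |r - 1|
  rcases h with h | h
  · rw [abs_of_nonpos (by linarith)]; linarith
  · rw [abs_of_nonneg (by linarith)]; linarith

theorem radialCutoff_eventually_eq_zero : ∀ᶠ x in 𝓝 (0 : AmbientSpace d), radialCutoff x = 0 := by
  have h : ∀ᶠ x in 𝓝 (0 : AmbientSpace d), ‖x‖ ^ 2 < 1 / 2 := by
    refine Tendsto.eventually_lt_const (v := 0) (by norm_num) ?_
    have : Continuous fun x : AmbientSpace d => ‖x‖ ^ 2 := by fun_prop
    simpa using this.tendsto 0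
  filter_upwards [h] with x hx using radialBump_eq_zero (.inl hx.le)

theorem radialCutoff_zero : radialCutoff (0 : AmbientSpace d) = 0 :=
  radialCutoff_eventually_eq_zero.self_of_nhds

theorem radialCutoff_eq_zero_of_notMem {x : AmbientSpace d}
    (hx : x ∉ Metric.closedBall (0 : AmbientSpace d) 2) : radialCutoff x = 0 := by
  refine radialBump_eq_zero (.inr ?_)
  have : 2 < ‖x‖ := by simpa using hx
  nlinarith

theorem hasCompactSupport_radialCutoff_mul (F : AmbientSpace d → ℝ) :
    HasCompactSupport fun x => radialCutoff x * F x :=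
  .intro (isCompact_closedBall 0 2) fun x hx => by simp [radialCutoff_eq_zero_of_notMem hx]

theorem contDiff_radialCutoff_mul {n : WithTop ℕ∞} (hn : n ≤ ∞) {F : AmbientSpace d → ℝ}
    (hF : ∀ x, x ≠ 0 → ContDiffAt ℝ n F x) :
    ContDiff ℝ n fun x => radialCutoff x * F x := by
  rw [contDiff_iff_contDiffAt]
  intro x
  by_cases hx : x = 0
  · subst hx
    refine (contDiffAt_const (c := (0 : ℝ))).congr_of_eventuallyEq ?_
    filter_upwards [radialCutoff_eventually_eq_zero] with y hy
    simp [hy]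
  · exact (contDiff_radialCutoff.contDiffAt.of_le hn).mul (hF x hx)

theorem fderiv_radialCutoff (x v : AmbientSpace d) :
    fderiv ℝ radialCutoff x v = deriv radialBump (‖x‖ ^ 2) * (2 * inner ℝ x v) := by
  have h1 : HasDerivAt radialBump (deriv radialBump (‖x‖ ^ 2)) (‖x‖ ^ 2) :=
    ((radialBump.contDiff (n := 1)).differentiable (by simp)).differentiableAt.hasDerivAt
  have h2 := h1.comp_hasFDerivAt x (hasStrictFDerivAt_norm_sq x).hasFDerivAt
  rw [show fderiv ℝ radialCutoff x = _ from h2.fderiv]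
  simp

/-- The gradient of the cutoff is radial and that of the extension is tangential, so the mixed term
of the product rule vanishes. -/
theorem laplacian_radialCutoff_mul {f : UnitSphere d → ℝ} (hf : ContMDiff (𝓡 d) 𝓘(ℝ, ℝ) ∞ f)
    {x : AmbientSpace d} (hx : x ≠ 0) :
    Δ (fun y => radialCutoff y * radialExtension f y) x =
      radialCutoff x * ((‖x‖ ^ 2)⁻¹ * sphereLaplacian f (totalProjection x)) +
        f (totalProjection x) * Δ radialCutoff x := by
  set b := stdOrthonormalBasis ℝ (AmbientSpace d)
  have h : ∑ i, fderiv ℝ radialCutoff x (b i) * fderiv ℝ (radialExtension f) x (b i) = 0 := by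
    have h1 := fderiv_radialExtension_self hf hx
    rw [← b.sum_repr' x, map_sum] at h1
    simp only [b.sum_repr' x, map_smul, smul_eq_mul] at h1
    simp only [fderiv_radialCutoff]
    calc _ = deriv radialBump (‖x‖ ^ 2) * 2 *
        ∑ i, inner ℝ (b i) x * fderiv ℝ (radialExtension f) x (b i) := by
          rw [Finset.mul_sum]
          exact Finset.sum_congr rfl fun i _ => by rw [real_inner_comm]; ring
      _ = 0 := by rw [h1, mul_zero]
  rw [laplacian_mul_eq b ((contDiff_radialCutoff (d := d)).contDiffAt.of_le two_le_smooth)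
    ((contDiffAt_radialExtension hf hx).of_le two_le_smooth), h, laplacian_radialExtension hf hx,
    radialExtension_eq f hx]
  ring

/-- The radial weight produced by integrating against the square of the cutoff. -/
noncomputable def radialWeight (r : ℝ) : ℝ := radialBump (r ^ 2) ^ 2 * (r ^ 2)⁻¹

/-- Positivity lets the radial factor be cancelled in Green's identity. -/
theorem integral_radialWeight_pos : 0 < ∫ x : AmbientSpace d, radialWeight ‖x‖ := by
  have h1 : Continuous fun x : AmbientSpace d => radialCutoff x * (radialCutoff x * (‖x‖ ^ 2)⁻¹) := by
    refine (contDiff_radialCutoff_mul (n := 0) (by simp) fun x hx => ?_).continuous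
    refine (contDiff_radialCutoff.contDiffAt.of_le (by simp)).mul (ContDiffAt.inv ?_ ?_)
    · exact (contDiff_norm_sq ℝ).contDiffAt
    · simpa using hx
  have h2 := hasCompactSupport_radialCutoff_mul
    fun x : AmbientSpace d => radialCutoff x * (‖x‖ ^ 2)⁻¹
  have h3 : ∀ x : AmbientSpace d,
      radialWeight ‖x‖ = radialCutoff x * (radialCutoff x * (‖x‖ ^ 2)⁻¹) := fun x => by
    simp only [radialWeight, radialCutoff]; ring
  simp only [h3]
  refine h1.integral_pos_of_hasCompactSupport_nonneg_nonzero h2 (fun x => ?_)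
    (x := (northPole d : AmbientSpace d)) ?_
  · rw [← h3]; simp only [radialWeight, Pi.zero_apply]; positivity
  · have : radialBump 1 = 1 := radialBump.one_of_mem_closedBall (by simp [radialBump.rIn_pos.le])
    simp [radialCutoff, this]

/-- Green's identity on the sphere. -/
theorem integral_mul_sphereLaplacian_sub {f g : UnitSphere d → ℝ}
    (hf : ContMDiff (𝓡 d) 𝓘(ℝ, ℝ) ∞ f) (hg : ContMDiff (𝓡 d) 𝓘(ℝ, ℝ) ∞ g) :
    ∫ x, (f x * sphereLaplacian g x - sphereLaplacian f x * g x) ∂(surfaceMeasure d) = 0 := by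
  have h := integral_mul_laplacian_sub_eq_zero
    (contDiff_radialCutoff_mul le_rfl fun x hx => contDiffAt_radialExtension hf hx)
    (hasCompactSupport_radialCutoff_mul _)
    (contDiff_radialCutoff_mul le_rfl fun x hx => contDiffAt_radialExtension hg hx)
    (hasCompactSupport_radialCutoff_mul _)
  set k := fun x => f x * sphereLaplacian g x - sphereLaplacian f x * g x
  -- The terms containing the Laplacian of the cutoff are symmetric in `f` and `g` and cancel; only
  -- a radial weight times `k` survives.
  have hk : ∫ x : AmbientSpace d, radialWeight ‖x‖ * k (totalProjection x) = 0 := by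
    rw [← h]
    refine integral_congr_ae (.of_forall fun x => ?_)
    by_cases hx : x = 0
    · subst hx
      simp [radialWeight, radialCutoff_zero]
    · simp only [laplacian_radialCutoff_mul hf hx, laplacian_radialCutoff_mul hg hx, k,
        radialExtension_eq f hx, radialExtension_eq g hx, radialWeight]
      simp only [radialCutoff]
      ring
  -- Taking the constant 1 on the sphere shows that the radial integral is a factor of a positive
  -- number, hence nonzero.
  have hw := integral_radial_mul (d := d) radialWeight 1
  simp only [Pi.one_apply, mul_one] at hw
  have hpos := integral_radialWeight_pos (d := d)
  rw [hw] at hpos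
  rw [integral_radial_mul, mul_eq_zero] at hk
  exact hk.resolve_right (right_ne_zero_of_mul hpos.ne')

end Green

/-! ### Differentiation under the integral over a compact space. -/

section CompactIntegral

variable {K : Type*} [TopologicalSpace K] [CompactSpace K] [MeasurableSpace K] [BorelSpace K]
  {μ : Measure K} [IsFiniteMeasure μ]

theorem hasDerivAt_integral_of_continuousOn_prod {F F' : ℝ → K → ℝ} {U : Set ℝ} (hU : IsOpen U)
    (hF : ContinuousOn (fun q : ℝ × K => F q.1 q.2) (U ×ˢ Set.univ))
    (hF' : ContinuousOn (fun q : ℝ × K => F' q.1 q.2) (U ×ˢ Set.univ))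
    (h : ∀ s ∈ U, ∀ z, HasDerivAt (fun s => F s z) (F' s z) s) {s : ℝ} (hs : s ∈ U) :
    HasDerivAt (fun s => ∫ z, F s z ∂μ) (∫ z, F' s z ∂μ) s := by
  obtain ⟨ε, hε, hεU⟩ := Metric.nhds_basis_closedBall.mem_iff.1 (hU.mem_nhds hs)
  obtain ⟨C, hC⟩ := ((isCompact_closedBall s ε).prod (isCompact_univ (X := K))).exists_bound_of_continuousOn
    (hF'.mono (Set.prod_mono hεU subset_rfl))
  have hc : ∀ G : ℝ → K → ℝ, ContinuousOn (fun q : ℝ × K => G q.1 q.2) (U ×ˢ Set.univ) →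
      ∀ r ∈ U, Continuous (G r) := fun G hG r hr =>
    hG.comp_continuous (f := fun z : K => (r, z)) (by fun_prop) fun z => ⟨hr, trivial⟩
  have hi : ∀ G : K → ℝ, Continuous G → Integrable G μ := fun G hG =>
    hG.integrable_of_hasCompactSupport (HasCompactSupport.of_compactSpace G)
  refine (hasDerivAt_integral_of_dominated_loc_of_deriv_le (F := F) (F' := F') (bound := fun _ => C)
    (Metric.closedBall_mem_nhds s hε) ?_ (hi _ (hc F hF s hs)) (hi _ (hc F' hF' s hs)).1
    (.of_forall fun z r hr => hC (r, z) ⟨hr, trivial⟩) (integrable_const C)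
    (.of_forall fun z r hr => h r (hεU hr) z)).2
  filter_upwards [hU.mem_nhds hs] with r hr using (hi _ (hc F hF r hr)).1

end CompactIntegral

/-! ### Uniqueness and symmetry of the heat kernel. -/

section HeatKernel

open scoped Manifold ContDiff

variable {d : ℕ} {p q : ℝ → UnitSphere d → UnitSphere d → ℝ}

namespace IsSphereHeatKernel

theorem contMDiff (hp : IsSphereHeatKernel d p) {t : ℝ} (ht : 0 < t) (x : UnitSphere d) :
    ContMDiff (𝓡 d) 𝓘(ℝ, ℝ) ∞ (p t x) := by
  have h : ContMDiff (𝓡 d) (𝓘(ℝ, ℝ).prod ((𝓡 d).prod (𝓡 d))) ∞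
      (fun z : UnitSphere d => (t, (x, z))) :=
    contMDiff_const.prodMk (contMDiff_const.prodMk contMDiff_id)
  exact hp.smooth.comp_contMDiff h fun z => ⟨ht, trivial⟩

theorem continuousOn (hp : IsSphereHeatKernel d p) (x : UnitSphere d) :
    ContinuousOn (fun r : ℝ × UnitSphere d => p r.1 x r.2) (Set.Ioi 0 ×ˢ Set.univ) :=
  hp.smooth.continuousOn.comp (f := fun r : ℝ × UnitSphere d => (r.1, (x, r.2)))
    (by fun_prop) fun r hr => ⟨hr.1, trivial⟩

theorem continuous_uncurry (hp : IsSphereHeatKernel d p) {t : ℝ} (ht : 0 < t) :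
    Continuous (fun r : UnitSphere d × UnitSphere d => p t r.1 r.2) :=
  hp.smooth.continuousOn.comp_continuous (f := fun r : UnitSphere d × UnitSphere d => (t, r))
    (by fun_prop) fun _ => ⟨ht, trivial⟩

/-- By the heat equation this function is the time derivative of the kernel, whose joint continuity
follows from joint smoothness. -/
theorem continuousOn_sphereLaplacian (hp : IsSphereHeatKernel d p) (x : UnitSphere d) :
    ContinuousOn (fun r : ℝ × UnitSphere d => (1 / 2) * sphereLaplacian (p r.1 x) r.2)
      (Set.Ioi 0 ×ˢ Set.univ) := by
  set G : ℝ × AmbientSpace d → ℝ := fun r => p r.1 x (totalProjection r.2)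
  have hG : ∀ s : ℝ, 0 < s → ∀ z : UnitSphere d, ContDiffAt ℝ ∞ G (s, (z : AmbientSpace d)) := by
    intro s hs z
    have h1 : ContMDiffAt 𝓘(ℝ, ℝ × AmbientSpace d) (𝓘(ℝ, ℝ).prod ((𝓡 d).prod (𝓡 d))) ∞
        (fun r : ℝ × AmbientSpace d => (r.1, (x, totalProjection r.2)))
        (s, (z : AmbientSpace d)) := by
      refine ContMDiffAt.prodMk contDiffAt_fst.contMDiffAt (contMDiffAt_const.prodMk ?_)
      exact (contMDiffAt_totalProjection (unitSphere_ne_zero z)).comp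
        (s, (z : AmbientSpace d)) contDiffAt_snd.contMDiffAt
    have h2 := hp.smooth.contMDiffAt (x := (s, (x, totalProjection (z : AmbientSpace d))))
      ((isOpen_Ioi.prod isOpen_univ).mem_nhds ⟨hs, trivial⟩)
    exact (h2.comp (s, (z : AmbientSpace d)) h1).contDiffAt
  have hd : ∀ r ∈ Set.Ioi (0 : ℝ) ×ˢ (Set.univ : Set (UnitSphere d)),
      (1 / 2) * sphereLaplacian (p r.1 x) r.2 =
        fderiv ℝ G (r.1, (r.2 : AmbientSpace d)) (1, 0) := by
    rintro ⟨s, z⟩ ⟨hs, -⟩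
    have h1 := ((hG s hs z).differentiableAt (by simp)).hasFDerivAt.comp_hasDerivAt s
      ((hasDerivAt_id s).prodMk (hasDerivAt_const s (z : AmbientSpace d)))
    refine (hp.heat_equation s hs x z).unique (h1.congr_of_eventuallyEq (.of_forall fun r => ?_))
    simp [G]
  refine ContinuousOn.congr ?_ hd
  rintro ⟨s, z⟩ ⟨hs, -⟩
  have h1 : ContinuousAt (fun r => fderiv ℝ G r (1, 0)) (s, (z : AmbientSpace d)) :=
    (((hG s hs z).fderiv_right (m := 0) (by simp)).clm_apply contDiffAt_const).continuousAt
  exact (h1.comp (f := fun r : ℝ × UnitSphere d => (r.1, (r.2 : AmbientSpace d)))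
    (x := (s, z)) (by fun_prop)).continuousWithinAt

theorem integrable_mul (hp : IsSphereHeatKernel d p) {t : ℝ} (ht : 0 < t) (x : UnitSphere d)
    {φ : UnitSphere d → ℝ} (hφ : Continuous φ) :
    Integrable (fun z => p t x z * φ z) (surfaceMeasure d) :=
  ((hp.contMDiff ht x).continuous.mul hφ).integrable_of_hasCompactSupport
    (HasCompactSupport.of_compactSpace _)

/-- The initial condition for time-dependent test functions: by compactness `u s` tends to `u 0`
uniformly, and the mass of the kernel stays bounded. -/
theorem tendsto_integral (hp : IsSphereHeatKernel d p) (x : UnitSphere d)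
    {u : ℝ → UnitSphere d → ℝ} {U : Set ℝ} (hU : IsOpen U) (h0 : 0 ∈ U)
    (hu : ContinuousOn (fun r : ℝ × UnitSphere d => u r.1 r.2) (U ×ˢ Set.univ)) :
    Tendsto (fun s => ∫ z, p s x z * u s z ∂(surfaceMeasure d)) (𝓝[>] 0) (𝓝 (u 0 x)) := by
  have hc : ∀ r ∈ U, Continuous (u r) := fun r hr =>
    hu.comp_continuous (f := fun z => (r, z)) (by fun_prop) fun z => ⟨hr, trivial⟩
  have h1 := hp.initial x ⟨u 0, hc 0 h0⟩
  -- The mass tends to 1, so it is eventually below 2; this matches the tolerance `ε / 2` used for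
  -- `u`.
  have h2 := hp.initial x 1
  simp only [ContinuousMap.coe_mk, ContinuousMap.one_apply, mul_one] at h1 h2
  have h3 : Tendsto (fun s => (∫ z, p s x z * u s z ∂(surfaceMeasure d)) -
      ∫ z, p s x z * u 0 z ∂(surfaceMeasure d)) (𝓝[>] 0) (𝓝 0) := by
    rw [Metric.tendsto_nhds]
    intro ε hε
    have h4 : ∀ᶠ s in 𝓝 (0 : ℝ), ∀ z ∈ (Set.univ : Set (UnitSphere d)),
        |u s z - u 0 z| < ε / 2 := by
      refine isCompact_univ.eventually_forall_of_forall_eventually fun z _ => ?_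
      have h5 : ContinuousAt (fun r : ℝ × UnitSphere d => |u r.1 r.2 - u 0 r.2|) (0, z) := by
        refine ContinuousAt.abs (ContinuousAt.sub ?_ ?_)
        · exact hu.continuousAt ((hU.prod isOpen_univ).mem_nhds ⟨h0, trivial⟩)
        · exact ((hc 0 h0).comp continuous_snd).continuousAt
      exact h5.eventually_lt_const (by simpa using hε)
    filter_upwards [h2.eventually_lt_const one_lt_two, self_mem_nhdsWithin,
      mem_nhdsWithin_of_mem_nhds h4, mem_nhdsWithin_of_mem_nhds (hU.mem_nhds h0)]
      with s hs1 hs hs4 hsU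
    have i0 : Integrable (p s x) (surfaceMeasure d) := by
      simpa using hp.integrable_mul hs x (continuous_const (y := (1 : ℝ)))
    rw [dist_zero_right, ← integral_sub (hp.integrable_mul hs x (hc s hsU))
      (hp.integrable_mul hs x (hc 0 h0))]
    calc _ ≤ ∫ z, p s x z * (ε / 2) ∂(surfaceMeasure d) := by
          refine norm_integral_le_of_norm_le (i0.mul_const _) (.of_forall fun z => ?_)
          rw [← mul_sub, norm_mul, Real.norm_of_nonneg (hp.nonneg s hs x z)]
          exact mul_le_mul_of_nonneg_left (hs4 z trivial).le (hp.nonneg s hs x z)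
      _ < ε := by rw [integral_mul_const]; nlinarith
  simpa using h3.add h1

/-- The heat equations give the derivative as one half of the antisymmetric expression in Green's
identity. -/
theorem hasDerivAt_integral_mul (hp : IsSphereHeatKernel d p) (hq : IsSphereHeatKernel d q)
    {t s : ℝ} (hs : s ∈ Set.Ioo 0 t) (x y : UnitSphere d) :
    HasDerivAt (fun s => ∫ z, p s x z * q (t - s) y z ∂(surfaceMeasure d)) 0 s := by
  have hsub : Set.MapsTo (fun r : ℝ × UnitSphere d => (t - r.1, r.2)) (Set.Ioo 0 t ×ˢ Set.univ)
      (Set.Ioi 0 ×ˢ Set.univ) := fun r hr =>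
    ⟨show (0 : ℝ) < t - r.1 from sub_pos.2 hr.1.2, trivial⟩
  have hmono : (Set.Ioo 0 t ×ˢ Set.univ : Set (ℝ × UnitSphere d)) ⊆ Set.Ioi 0 ×ˢ Set.univ :=
    Set.prod_mono Set.Ioo_subset_Ioi_self subset_rfl
  have hcont : ContinuousOn (fun r : ℝ × UnitSphere d => (t - r.1, r.2))
      (Set.Ioo 0 t ×ˢ Set.univ) := by fun_prop
  have c1 : ContinuousOn (fun r : ℝ × UnitSphere d => p r.1 x r.2) (Set.Ioo 0 t ×ˢ Set.univ) :=
    (hp.continuousOn x).mono hmono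
  have c2 : ContinuousOn (fun r : ℝ × UnitSphere d => q (t - r.1) y r.2)
      (Set.Ioo 0 t ×ˢ Set.univ) := (hq.continuousOn y).comp hcont hsub
  have c3 : ContinuousOn (fun r : ℝ × UnitSphere d => (1 / 2) * sphereLaplacian (p r.1 x) r.2)
      (Set.Ioo 0 t ×ˢ Set.univ) := (hp.continuousOn_sphereLaplacian x).mono hmono
  have c4 : ContinuousOn
      (fun r : ℝ × UnitSphere d => (1 / 2) * sphereLaplacian (q (t - r.1) y) r.2)
      (Set.Ioo 0 t ×ˢ Set.univ) := by
    have := (hq.continuousOn_sphereLaplacian y).comp hcont hsub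
    simpa only [Function.comp_def] using this
  have hd : ∀ s ∈ Set.Ioo 0 t, ∀ z, HasDerivAt (fun s => p s x z * q (t - s) y z)
      ((1 / 2) * sphereLaplacian (p s x) z * q (t - s) y z -
        p s x z * ((1 / 2) * sphereLaplacian (q (t - s) y) z)) s := by
    intro s hs z
    have h2 : HasDerivAt (fun s => q (t - s) y z)
        ((1 / 2) * sphereLaplacian (q (t - s) y) z * (-1)) s :=
      (hq.heat_equation (t - s) (sub_pos.2 hs.2) y z).comp s ((hasDerivAt_id s).const_sub t)
    refine ((hp.heat_equation s hs.1 x z).fun_mul h2).congr_deriv ?_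
    ring
  have h1 := hasDerivAt_integral_of_continuousOn_prod (μ := surfaceMeasure d) isOpen_Ioo
    (c1.mul c2) ((c3.mul c2).sub (c1.mul c4)) hd hs
  have h4 := integral_mul_sphereLaplacian_sub (hp.contMDiff hs.1 x)
    (hq.contMDiff (sub_pos.2 hs.2) y)
  refine h1.congr_deriv ?_
  rw [← mul_zero (-(1 / 2) : ℝ), ← h4, ← integral_const_mul]
  congr 1
  ext z
  ring

/-- Any two heat kernels are transposes of each other. -/
theorem eq_swap (hp : IsSphereHeatKernel d p) (hq : IsSphereHeatKernel d q) {t : ℝ} (ht : 0 < t)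
    (x y : UnitSphere d) : p t x y = q t y x := by
  -- Comparing the times `s` and `t - s` turns the limit at `t` into a second limit at `0`, where
  -- `tendsto_integral` applies to `q`.
  have hconst : ∀ s ∈ Set.Ioo 0 t, ∫ z, p s x z * q (t - s) y z ∂(surfaceMeasure d) =
      ∫ z, p (t - s) x z * q (t - (t - s)) y z ∂(surfaceMeasure d) := fun s hs =>
    isOpen_Ioo.is_const_of_deriv_eq_zero isPreconnected_Ioo
      (fun r hr => (hp.hasDerivAt_integral_mul hq hr x y).differentiableAt.differentiableWithinAt)
      (fun r hr => (hp.hasDerivAt_integral_mul hq hr x y).deriv) hs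
      ⟨sub_pos.2 hs.2, by linarith [hs.1]⟩
  have hsub : Set.MapsTo (fun r : ℝ × UnitSphere d => (t - r.1, r.2)) (Set.Iio t ×ˢ Set.univ)
      (Set.Ioi 0 ×ˢ Set.univ) := fun r hr =>
    ⟨show (0 : ℝ) < t - r.1 from sub_pos.2 hr.1, trivial⟩
  have hcont : ContinuousOn (fun r : ℝ × UnitSphere d => (t - r.1, r.2))
      (Set.Iio t ×ˢ Set.univ) := by fun_prop
  have l1 := hp.tendsto_integral x (u := fun s z => q (t - s) y z) isOpen_Iio ht
    ((hq.continuousOn y).comp hcont hsub)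
  have l2 := hq.tendsto_integral y (u := fun s z => p (t - s) x z) isOpen_Iio ht
    ((hp.continuousOn x).comp hcont hsub)
  simp only [sub_zero] at l1 l2
  refine tendsto_nhds_unique (l2.congr' ?_) l1
  filter_upwards [Ioo_mem_nhdsGT ht] with s hs
  rw [hconst s hs, sub_sub_cancel]
  simp only [mul_comm]

end IsSphereHeatKernel

end HeatKernel

/-! ### Linear isometries acting on the sphere. -/

section Isometry

open scoped Manifold ContDiff Pointwise

variable {d : ℕ}

/-- The action of a linear isometry on the sphere. -/
noncomputable def sphereMap (U : AmbientSpace d ≃ₗᵢ[ℝ] AmbientSpace d) (x : UnitSphere d) : UnitSphere d :=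
  ⟨U x, by simp⟩

@[simp] theorem coe_sphereMap (U : AmbientSpace d ≃ₗᵢ[ℝ] AmbientSpace d) (x : UnitSphere d) :
    (sphereMap U x : AmbientSpace d) = U x := rfl

@[simp] theorem sphereMap_symm_sphereMap (U : AmbientSpace d ≃ₗᵢ[ℝ] AmbientSpace d)
    (x : UnitSphere d) : sphereMap U.symm (sphereMap U x) = x := by
  ext1; simp

@[simp] theorem sphereMap_sphereMap_symm (U : AmbientSpace d ≃ₗᵢ[ℝ] AmbientSpace d)
    (x : UnitSphere d) : sphereMap U (sphereMap U.symm x) = x := by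
  ext1; simp

theorem continuous_sphereMap (U : AmbientSpace d ≃ₗᵢ[ℝ] AmbientSpace d) :
    Continuous (sphereMap U) :=
  (U.continuous.comp continuous_subtype_val).subtype_mk _

theorem contMDiff_sphereMap (U : AmbientSpace d ≃ₗᵢ[ℝ] AmbientSpace d) :
    ContMDiff (𝓡 d) (𝓡 d) ∞ (sphereMap U) := by
  have := Fact.mk (finrank_euclideanSpace_fin (𝕜 := ℝ) (n := d + 1))
  have h : ContMDiff (𝓡 d) 𝓘(ℝ, AmbientSpace d) ∞ (fun x : UnitSphere d => U x) :=
    (U.toContinuousLinearEquiv.contDiff.contMDiff).comp contMDiff_coe_sphere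
  exact h.codRestrict_sphere fun x => by simp

/-- The isometry carries the cone over a set to the cone over its image and preserves Lebesgue
measure. -/
theorem measurePreserving_sphereMap (U : AmbientSpace d ≃ₗᵢ[ℝ] AmbientSpace d) :
    MeasurePreserving (sphereMap U) (surfaceMeasure d) (surfaceMeasure d) := by
  refine ⟨(continuous_sphereMap U).measurable, ?_⟩
  ext A hA
  rw [Measure.map_apply (continuous_sphereMap U).measurable hA, surfaceMeasure,
    Measure.toSphere_apply' _ ((continuous_sphereMap U).measurable hA),
    Measure.toSphere_apply' _ hA, ← U.measurePreserving.measure_preimage_equiv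
      (f := U.toMeasurableEquiv)
      (Set.Ioo (0 : ℝ) 1 • (Subtype.val '' A))]
  congr 2
  ext x
  simp only [Set.mem_smul, Set.mem_image, Set.mem_preimage]
  constructor
  · rintro ⟨r, hr, _, ⟨a, ha, rfl⟩, rfl⟩
    exact ⟨r, hr, _, ⟨sphereMap U a, ha, rfl⟩, by simp⟩
  · rintro ⟨r, hr, _, ⟨a, ha, rfl⟩, h⟩
    refine ⟨r, hr, _, ⟨sphereMap U.symm a, by simpa using ha, rfl⟩, U.injective ?_⟩
    simpa using h

theorem sphereLaplacian_comp_sphereMap (U : AmbientSpace d ≃ₗᵢ[ℝ] AmbientSpace d)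
    {f : UnitSphere d → ℝ} (hf : ContMDiff (𝓡 d) 𝓘(ℝ, ℝ) ∞ f) (x : UnitSphere d) :
    sphereLaplacian (fun y => f (sphereMap U y)) x = sphereLaplacian f (sphereMap U x) := by
  have h : radialExtension (fun y => f (sphereMap U y)) = fun y => radialExtension f (U y) := by
    ext y
    by_cases hy : y = 0
    · simp [radialExtension, hy]
    · rw [radialExtension_eq _ hy, radialExtension_eq _ (by simpa using hy)]
      congr 1
      ext1
      rw [totalProjection_linearIsometryEquiv U hy, coe_sphereMap]
  rw [sphereLaplacian, h]
  exact laplacian_comp_linearIsometryEquiv U ((contDiffAt_radialExtension hf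
    (unitSphere_ne_zero (sphereMap U x))).of_le two_le_smooth)

theorem IsSphereHeatKernel.comp_sphereMap {p : ℝ → UnitSphere d → UnitSphere d → ℝ}
    (hp : IsSphereHeatKernel d p) (U : AmbientSpace d ≃ₗᵢ[ℝ] AmbientSpace d) :
    IsSphereHeatKernel d fun t x y => p t (sphereMap U x) (sphereMap U y) where
  smooth := by
    have h : ContMDiff (𝓘(ℝ, ℝ).prod ((𝓡 d).prod (𝓡 d))) (𝓘(ℝ, ℝ).prod ((𝓡 d).prod (𝓡 d))) ∞
        (fun q : ℝ × UnitSphere d × UnitSphere d =>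
          (q.1, (sphereMap U q.2.1, sphereMap U q.2.2))) :=
      contMDiff_fst.prodMk (((contMDiff_sphereMap U).comp (contMDiff_fst.comp contMDiff_snd)).prodMk
        ((contMDiff_sphereMap U).comp (contMDiff_snd.comp contMDiff_snd)))
    exact hp.smooth.comp h.contMDiffOn fun q hq => ⟨hq.1, trivial⟩
  nonneg t ht x y := hp.nonneg t ht _ _
  heat_equation t ht x y := by
    rw [sphereLaplacian_comp_sphereMap U (hp.contMDiff ht _)]
    exact hp.heat_equation t ht _ _
  initial x φ := by
    have h := hp.initial (sphereMap U x)
      ⟨fun y => φ (sphereMap U.symm y), φ.continuous.comp (continuous_sphereMap U.symm)⟩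
    simp only [ContinuousMap.coe_mk, sphereMap_symm_sphereMap] at h
    refine h.congr' ?_
    filter_upwards [self_mem_nhdsWithin] with t ht
    have hc : Continuous fun y => p t (sphereMap U x) y * φ (sphereMap U.symm y) :=
      (hp.contMDiff ht _).continuous.mul (φ.continuous.comp (continuous_sphereMap U.symm))
    have h2 := integral_map (measurePreserving_sphereMap U).aemeasurable
      (f := fun y => p t (sphereMap U x) y * φ (sphereMap U.symm y))
      (hc.aestronglyMeasurable)
    rw [(measurePreserving_sphereMap U).map_eq] at h2
    rw [h2]
    simp only [sphereMap_symm_sphereMap]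

end Isometry

/-! ### Isometry invariance of the chosen heat kernel. -/

section HeatKernelSymmetry

variable {d : ℕ} {t : ℝ}

/-- The transported kernel is again a heat kernel, so `eq_swap` compares it with the original. The
fallback value 0 has the symmetry trivially. -/
theorem sphereHeatKernel_sphereMap_swap (ht : 0 < t)
    (U : AmbientSpace d ≃ₗᵢ[ℝ] AmbientSpace d) (x y : UnitSphere d) :
    sphereHeatKernel d t (sphereMap U x) (sphereMap U y) = sphereHeatKernel d t y x := by
  unfold sphereHeatKernel
  split_ifs with h
  · exact (h.choose_spec.comp_sphereMap U).eq_swap h.choose_spec ht x y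
  · rfl

theorem sphereHeatKernel_comm (ht : 0 < t) (x y : UnitSphere d) :
    sphereHeatKernel d t x y = sphereHeatKernel d t y x :=
  sphereHeatKernel_sphereMap_swap ht (.refl ℝ _) x y

theorem sphereHeatKernel_nonneg (ht : 0 < t) (x y : UnitSphere d) :
    0 ≤ sphereHeatKernel d t x y := by
  unfold sphereHeatKernel
  split_ifs with h
  · exact h.choose_spec.nonneg t ht x y
  · exact le_rfl

theorem continuous_sphereHeatKernel (ht : 0 < t) :
    Continuous fun r : UnitSphere d × UnitSphere d => sphereHeatKernel d t r.1 r.2 := by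
  unfold sphereHeatKernel
  split_ifs with h
  · exact h.choose_spec.continuous_uncurry ht
  · exact continuous_const

end HeatKernelSymmetry

/-! ### The reflection exchanging two points of the sphere. -/

section Reflection

variable {d : ℕ}

/-- The action on the sphere of the reflection in the line spanned by `a + b`. -/
noncomputable def reflectMap (a b : UnitSphere d) : UnitSphere d → UnitSphere d :=
  sphereMap (lineReflection ((a : AmbientSpace d) + b))

theorem reflectMap_comm (a b : UnitSphere d) : reflectMap a b = reflectMap b a := by
  rw [reflectMap, add_comm, reflectMap]

theorem reflectMap_left (a b : UnitSphere d) : reflectMap a b a = b := by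
  ext1
  rw [reflectMap, coe_sphereMap, lineReflection_apply]
  -- For antipodal points the convention that the reflection in 0 is `-id` is what still exchanges
  -- them.
  by_cases h : (a : AmbientSpace d) + b = 0
  · simp [eq_neg_of_add_eq_zero_right h]
  · have ha : ‖(a : AmbientSpace d)‖ = 1 := norm_eq_of_mem_sphere a
    have hb : ‖(b : AmbientSpace d)‖ = 1 := norm_eq_of_mem_sphere b
    have h1 : ‖(a : AmbientSpace d) + b‖ ^ 2 = 2 * inner ℝ ((a : AmbientSpace d) + b) a := by
      rw [norm_add_sq_real, inner_add_left, real_inner_self_eq_norm_sq, ha, hb,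
        real_inner_comm]
      ring
    have h2 : ‖(a : AmbientSpace d) + b‖ ^ 2 ≠ 0 := pow_ne_zero 2 (norm_ne_zero_iff.2 h)
    rw [mul_right_comm, ← h1, mul_inv_cancel₀ h2, one_smul, add_sub_cancel_left]

theorem reflectMap_right (a b : UnitSphere d) : reflectMap a b b = a := by
  rw [reflectMap_comm, reflectMap_left]

theorem measurePreserving_reflectMap (a b : UnitSphere d) :
    MeasurePreserving (reflectMap a b) (surfaceMeasure d) (surfaceMeasure d) :=
  measurePreserving_sphereMap _

/-- Continuity can fail at antipodal pairs; the explicit formula is nevertheless measurable. -/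
theorem Measurable.reflectMap {α : Type*} [MeasurableSpace α] {f g h : α → UnitSphere d}
    (hf : Measurable f) (hg : Measurable g) (hh : Measurable h) :
    Measurable fun a => reflectMap (f a) (g a) (h a) := by
  refine Measurable.subtype_mk ?_
  simp only [lineReflection_apply]
  have h1 : Measurable fun a => (f a : AmbientSpace d) + (g a : AmbientSpace d) :=
    hf.subtype_coe.add hg.subtype_coe
  exact ((((h1.norm.pow_const 2).inv.const_mul 2).mul (h1.inner hh.subtype_coe)).smul h1).sub
    hh.subtype_coe

theorem sphereHeatKernel_reflectMap_right {t : ℝ} (ht : 0 < t) (a b x : UnitSphere d) :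
    sphereHeatKernel d t a (reflectMap a b x) = sphereHeatKernel d t x b := by
  have h := sphereHeatKernel_sphereMap_swap ht
    (lineReflection ((a : AmbientSpace d) + (b : AmbientSpace d))) b x
  change sphereHeatKernel d t (reflectMap a b b) (reflectMap a b x) = _ at h
  rwa [reflectMap_right] at h

theorem sphereHeatKernel_reflectMap_left {t : ℝ} (ht : 0 < t) (a b x : UnitSphere d) :
    sphereHeatKernel d t (reflectMap a b x) b = sphereHeatKernel d t a x := by
  have h := sphereHeatKernel_sphereMap_swap ht
    (lineReflection ((a : AmbientSpace d) + (b : AmbientSpace d))) x a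
  change sphereHeatKernel d t (reflectMap a b x) (reflectMap a b a) = _ at h
  rwa [reflectMap_left] at h

/-- The total mass of the heat kernel does not depend on the starting point. -/
theorem lintegral_sphereHeatKernel_eq {t : ℝ} (ht : 0 < t) (x y : UnitSphere d) :
    ∫⁻ z, ENNReal.ofReal (sphereHeatKernel d t x z) ∂(surfaceMeasure d) =
      ∫⁻ z, ENNReal.ofReal (sphereHeatKernel d t y z) ∂(surfaceMeasure d) := by
  have hm : ∀ x : UnitSphere d, Measurable fun z => ENNReal.ofReal (sphereHeatKernel d t x z) :=
    fun x => ((continuous_sphereHeatKernel ht).comp (Continuous.prodMk_right x)).measurable.ennreal_ofReal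
  -- Substitute the measure preserving reflection that exchanges `x` and `y`.
  rw [← (measurePreserving_reflectMap x y).lintegral_comp (hm x)]
  congr 1
  ext z
  rw [sphereHeatKernel_reflectMap_right ht, sphereHeatKernel_comm ht]

end Reflection

/-! ### Changing or integrating out one coordinate of a product measure. -/

section PiCoordinate

open scoped ENNReal

variable {S : Type*} [MeasurableSpace S] {μ : Measure S} [SigmaFinite μ] {n : ℕ}

/-- Moving one coordinate by a measure preserving map which depends measurably on the other
coordinates preserves the product measure. -/
theorem measurePreserving_pi_update (i : Fin (n + 1)) {T : (Fin n → S) → S → S}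
    (hT : Measurable (Function.uncurry T)) (hT' : ∀ y, MeasurePreserving (T y) μ μ) :
    MeasurePreserving (fun x : Fin (n + 1) → S =>
      Function.update x i (T (fun j => x (i.succAbove j)) (x i)))
      (Measure.pi fun _ => μ) (Measure.pi fun _ => μ) := by
  have e := measurePreserving_piFinSuccAbove (fun _ : Fin (n + 1) => μ) i
  have h1 : MeasurePreserving (fun y : (Fin n → S) × S => (y.1, T y.1 y.2))
      ((Measure.pi fun _ => μ).prod μ) ((Measure.pi fun _ => μ).prod μ) :=
    (MeasurePreserving.id _).skew_product hT (.of_forall fun y => (hT' y).map_eq)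
  have h2 := (e.symm _).comp (Measure.measurePreserving_swap.comp
    (h1.comp (Measure.measurePreserving_swap.comp e)))
  convert h2 using 1
  ext1 x
  simp only [Function.comp_apply, MeasurableEquiv.piFinSuccAbove_apply, Prod.swap,
    MeasurableEquiv.piFinSuccAbove_symm_apply, Fin.insertNthEquiv]
  ext1 j
  rcases Fin.eq_self_or_eq_succAbove i j with rfl | ⟨k, rfl⟩
  · simp only [Function.update_self, Equiv.coe_fn_mk, Fin.insertNth_apply_same]
    rfl
  · simp [Fin.removeNth]

/-- Integrating out one coordinate of a density on a product space. -/
theorem map_succAbove_withDensity_pi (i : Fin (n + 1)) {ρ : (Fin (n + 1) → S) → ℝ≥0∞}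
    {ρ' : (Fin n → S) → ℝ≥0∞} {w : (Fin n → S) → S → ℝ≥0∞} {c : ℝ≥0∞}
    (hρ' : Measurable ρ') (hw : Measurable (Function.uncurry w))
    (hρ : ∀ x, ρ x = ρ' (fun j => x (i.succAbove j)) * w (fun j => x (i.succAbove j)) (x i))
    (hc : ∀ y, ∫⁻ z, w y z ∂μ = c) :
    ((Measure.pi fun _ : Fin (n + 1) => μ).withDensity ρ).map (fun x j => x (i.succAbove j)) =
      c • (Measure.pi fun _ : Fin n => μ).withDensity ρ' := by
  have e := measurePreserving_piFinSuccAbove (fun _ : Fin (n + 1) => μ) i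
  have hr : Measurable fun (x : Fin (n + 1) → S) (j : Fin n) => x (i.succAbove j) := by fun_prop
  ext A hA
  rw [Measure.map_apply hr hA, withDensity_apply _ (hr hA), Measure.smul_apply,
    withDensity_apply _ hA, smul_eq_mul, ← lintegral_indicator (hr hA), ← lintegral_indicator hA]
  have h1 : ∀ x, ((fun (x : Fin (n + 1) → S) (j : Fin n) => x (i.succAbove j)) ⁻¹' A).indicator ρ x =
      (fun y : S × (Fin n → S) => A.indicator ρ' y.2 * w y.2 y.1)
        (MeasurableEquiv.piFinSuccAbove (fun _ => S) i x) := by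
    intro x
    change _ = A.indicator ρ' (fun j => x (i.succAbove j)) * w (fun j => x (i.succAbove j)) (x i)
    by_cases hx : (fun j => x (i.succAbove j)) ∈ A
    · simp [Set.indicator, hx, hρ]
    · simp [Set.indicator, hx]
  have hm : Measurable fun y : S × (Fin n → S) => A.indicator ρ' y.2 * w y.2 y.1 :=
    ((hρ'.indicator hA).comp measurable_snd).mul (hw.comp measurable_swap)
  simp only [h1]
  rw [e.lintegral_comp hm, lintegral_prod_symm _ hm.aemeasurable,
    ← lintegral_const_mul _ (hρ'.indicator hA)]
  congr 1
  ext y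
  have hwy : Measurable (w y) := hw.comp measurable_prodMk_left
  change ∫⁻ z, A.indicator ρ' y * w y z ∂μ = _
  rw [lintegral_const_mul _ hwy, hc, mul_comm]

end PiCoordinate

/-! ### The law of the heat chain: local moves and marginals. -/

section Chain

open scoped ENNReal

variable {d N : ℕ} {t : ℝ}

/-- The density of the heat Markov chain. -/
noncomputable def chainDensity (d : ℕ) (t : ℝ) {N : ℕ} (x : Fin (N + 1) → UnitSphere d) : ℝ≥0∞ :=
  ENNReal.ofReal (((surfaceMeasure d).real Set.univ)⁻¹ *
    ∏ n : Fin N, sphereHeatKernel d t (x n.castSucc) (x n.succ))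

/-- The law of the heat Markov chain. -/
noncomputable def chainMeasure (d : ℕ) (t : ℝ) (N : ℕ) : Measure (Fin (N + 1) → UnitSphere d) :=
  (Measure.pi fun _ => surfaceMeasure d).withDensity (chainDensity d t)

theorem Measurable.sphereHeatKernel (ht : 0 < t) {α : Type*} [MeasurableSpace α]
    {f g : α → UnitSphere d} (hf : Measurable f) (hg : Measurable g) :
    Measurable fun a => sphereHeatKernel d t (f a) (g a) :=
  (continuous_sphereHeatKernel ht).measurable.comp (hf.prodMk hg)

theorem measurable_chainDensity (ht : 0 < t) :
    Measurable (chainDensity d t (N := N)) := by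
  refine Measurable.ennreal_ofReal (Measurable.const_mul ?_ _)
  refine Finset.measurable_fun_prod _ fun n _ => ?_
  exact .sphereHeatKernel ht (measurable_pi_apply _) (measurable_pi_apply _)

/-- Reflection of the point number `a + 1` of a sequence according to its two neighbours. -/
noncomputable def flipAt (a b : Fin N) (x : Fin (N + 1) → UnitSphere d) :
    Fin (N + 1) → UnitSphere d :=
  Function.update x a.succ (reflectMap (x a.castSucc) (x b.succ) (x a.succ))

theorem chainDensity_flipAt (ht : 0 < t) {a b : Fin N} (hab : (b : ℕ) = a + 1)
    (x : Fin (N + 1) → UnitSphere d) : chainDensity d t (flipAt a b x) = chainDensity d t x := by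
  have hba : b.castSucc = a.succ := Fin.ext (by simp [hab])
  have hne : a ≠ b := fun h => by subst h; omega
  unfold chainDensity
  congr 2
  -- The flip exchanges the factors at `a` and `b`, so the products match after a transposition of
  -- the indices.
  rw [← Equiv.prod_comp (Equiv.swap a b)
    fun n : Fin N => sphereHeatKernel d t (x n.castSucc) (x n.succ)]
  refine Finset.prod_congr rfl fun n _ => ?_
  by_cases hna : n = a
  · subst hna
    have : n.castSucc ≠ n.succ := Fin.castSucc_lt_succ.ne
    simp [flipAt, this, hba, sphereHeatKernel_reflectMap_right ht]
  by_cases hnb : n = b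
  · subst hnb
    have : n.succ ≠ a.succ := fun h => hne (Fin.succ_injective _ h).symm
    simp [flipAt, this, hba, sphereHeatKernel_reflectMap_left ht]
  have h1 : n.castSucc ≠ a.succ := fun h => hnb (Fin.castSucc_injective _ (h.trans hba.symm))
  have h2 : n.succ ≠ a.succ := fun h => hna (Fin.succ_injective _ h)
  simp [flipAt, h1, h2, Equiv.swap_apply_of_ne_of_ne hna hnb]

theorem measurePreserving_flipAt {a b : Fin N} (hab : (b : ℕ) = a + 1) :
    MeasurePreserving (flipAt (d := d) a b) (Measure.pi fun _ => surfaceMeasure d)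
      (Measure.pi fun _ => surfaceMeasure d) := by
  -- Both neighbours are coordinates other than the moved one, so the reflection stays fixed while
  -- that point varies.
  obtain ⟨k, hk⟩ := Fin.exists_succAbove_eq (x := a.castSucc) (y := a.succ)
    (Fin.castSucc_lt_succ (i := a)).ne
  obtain ⟨l, hl⟩ := Fin.exists_succAbove_eq (x := b.succ) (y := a.succ)
    (fun h => by have := Fin.succ_injective _ h; omega)
  have h := measurePreserving_pi_update (μ := surfaceMeasure d) a.succ
    (T := fun y => reflectMap (y k) (y l))
    (Measurable.reflectMap (by fun_prop) (by fun_prop) measurable_snd)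
    fun y => measurePreserving_reflectMap _ _
  simp only [hk, hl] at h
  exact h

theorem map_flipAt_chainMeasure (ht : 0 < t) {a b : Fin N} (hab : (b : ℕ) = a + 1) :
    (chainMeasure d t N).map (flipAt a b) = chainMeasure d t N := by
  have h := measurePreserving_flipAt (d := d) hab
  ext A hA
  rw [Measure.map_apply h.measurable hA, chainMeasure, withDensity_apply _ (h.measurable hA),
    withDensity_apply _ hA, ← h.setLIntegral_comp_preimage hA (measurable_chainDensity ht)]
  simp only [chainDensity_flipAt ht hab]

/-- The total mass of the heat kernel. -/
noncomputable def heatMass (d : ℕ) (t : ℝ) : ℝ≥0∞ :=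
  ∫⁻ z, ENNReal.ofReal (sphereHeatKernel d t (northPole d) z) ∂(surfaceMeasure d)

/-- The last point enters only the last factor, whose integral is independent of the preceding
point. -/
theorem map_castSucc_chainMeasure (ht : 0 < t) :
    (chainMeasure d t (N + 1)).map (fun x j => x j.castSucc) =
      heatMass d t • chainMeasure d t N := by
  have h := map_succAbove_withDensity_pi (μ := surfaceMeasure d) (Fin.last (N + 1))
    (ρ := chainDensity d t) (ρ' := chainDensity d t)
    (w := fun y z => ENNReal.ofReal (sphereHeatKernel d t (y (Fin.last N)) z))
    (c := heatMass d t) (measurable_chainDensity ht)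
    (Measurable.sphereHeatKernel ht (by fun_prop) measurable_snd).ennreal_ofReal
    (fun x => by
      rw [chainDensity, chainDensity, ← ENNReal.ofReal_mul (by
        have := fun i : Fin N => sphereHeatKernel_nonneg ht
          (x ((Fin.last (N + 1)).succAbove i.castSucc)) (x ((Fin.last (N + 1)).succAbove i.succ))
        have := Finset.prod_nonneg fun i (_ : i ∈ Finset.univ) => this i
        positivity), Fin.prod_univ_castSucc, mul_assoc]
      simp only [Fin.succAbove_last, Fin.succ_last, Fin.succ_castSucc])
    (fun y => lintegral_sphereHeatKernel_eq ht _ _)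
  simp only [Fin.succAbove_last] at h
  exact h

/-- Symmetry of the kernel lets the first point be integrated out in the same way. -/
theorem map_succ_chainMeasure (ht : 0 < t) :
    (chainMeasure d t (N + 1)).map (fun x j => x j.succ) =
      heatMass d t • chainMeasure d t N := by
  have h := map_succAbove_withDensity_pi (μ := surfaceMeasure d) (0 : Fin (N + 2))
    (ρ := chainDensity d t) (ρ' := chainDensity d t)
    (w := fun y z => ENNReal.ofReal (sphereHeatKernel d t (y 0) z))
    (c := heatMass d t) (measurable_chainDensity ht)
    (Measurable.sphereHeatKernel ht (by fun_prop) measurable_snd).ennreal_ofReal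
    (fun x => by
      rw [chainDensity, chainDensity, ← ENNReal.ofReal_mul (by
        have := fun i : Fin N => sphereHeatKernel_nonneg ht
          (x ((0 : Fin (N + 2)).succAbove i.castSucc)) (x ((0 : Fin (N + 2)).succAbove i.succ))
        have := Finset.prod_nonneg fun i (_ : i ∈ Finset.univ) => this i
        positivity), Fin.prod_univ_succ, mul_assoc, sphereHeatKernel_comm ht (x (0 : Fin _).castSucc),
        mul_comm (sphereHeatKernel d t _ _)]
      simp)
    (fun y => lintegral_sphereHeatKernel_eq ht _ _)
  simp only [Fin.zero_succAbove] at h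
  exact h

theorem chainMeasure_univ (ht : 0 < t) (N : ℕ) :
    chainMeasure d t N Set.univ = heatMass d t ^ N := by
  induction N with
  | zero =>
    have h0 : (surfaceMeasure d) Set.univ ≠ 0 := by
      rw [Measure.measure_univ_ne_zero, surfaceMeasure]
      exact Measure.toSphere_ne_zero _
    rw [chainMeasure, withDensity_apply _ .univ]
    simp only [chainDensity, Finset.univ_eq_empty, Finset.prod_empty, mul_one, lintegral_const,
      Measure.restrict_univ, Measure.pi_univ, pow_zero]
    rw [ENNReal.ofReal_inv_of_pos (by
      rw [measureReal_def]; exact ENNReal.toReal_pos h0 (measure_ne_top _ _)), ofReal_measureReal]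
    simpa using ENNReal.inv_mul_cancel h0 (measure_ne_top _ _)
  | succ N ih =>
    have h := congrArg (fun ν => ν Set.univ) (map_castSucc_chainMeasure (d := d) (N := N) ht)
    simp only [Measure.smul_apply, ih, smul_eq_mul] at h
    rw [Measure.map_apply (by fun_prop) .univ, Set.preimage_univ] at h
    rw [h, pow_succ']

variable {Ω : Type*} [MeasurableSpace Ω] {P : Measure Ω}

theorem IsHeatMarkovChain.flipAt {X : Ω → Fin (N + 1) → UnitSphere d}
    (hX : IsHeatMarkovChain P t X) (ht : 0 < t) {a b : Fin N} (hab : (b : ℕ) = a + 1) :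
    IsHeatMarkovChain P t fun ω => flipAt a b (X ω) := by
  have hm := (measurePreserving_flipAt (d := d) hab).measurable
  refine ⟨hm.comp_aemeasurable hX.aemeasurable, ?_⟩
  change P.map (_root_.flipAt a b ∘ X) = chainMeasure d t N
  rw [← AEMeasurable.map_map_of_aemeasurable hm.aemeasurable hX.aemeasurable, hX.map_eq]
  exact map_flipAt_chainMeasure ht hab

/-- The law has mass `heatMass d t ^ (N + 1)` and is a probability; at least one step makes the
exponent nonzero. -/
theorem IsHeatMarkovChain.heatMass_eq_one [IsProbabilityMeasure P]
    {X : Ω → Fin (N + 2) → UnitSphere d} (hX : IsHeatMarkovChain P t X) (ht : 0 < t) :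
    heatMass d t = 1 := by
  have h : P.map X = chainMeasure d t (N + 1) := hX.map_eq
  have h1 : P.map X Set.univ = 1 := by
    rw [Measure.map_apply_of_aemeasurable hX.aemeasurable .univ, Set.preimage_univ, measure_univ]
  rw [h, chainMeasure_univ ht] at h1
  exact (ENNReal.pow_right_strictMono (Nat.succ_ne_zero N)).injective (by simpa using h1)

theorem IsHeatMarkovChain.castSucc [IsProbabilityMeasure P]
    {X : Ω → Fin (N + 2) → UnitSphere d} (hX : IsHeatMarkovChain P t X) (ht : 0 < t) :
    IsHeatMarkovChain P t fun ω (j : Fin (N + 1)) => X ω j.castSucc := by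
  have hm : Measurable fun (x : Fin (N + 2) → UnitSphere d) (j : Fin (N + 1)) => x j.castSucc := by
    fun_prop
  have h := map_castSucc_chainMeasure (d := d) (N := N) ht
  rw [hX.heatMass_eq_one ht, one_smul] at h
  refine ⟨hm.comp_aemeasurable hX.aemeasurable, ?_⟩
  change _ = chainMeasure d t N
  rw [← h, ← show P.map X = chainMeasure d t (N + 1) from hX.map_eq,
    AEMeasurable.map_map_of_aemeasurable hm.aemeasurable hX.aemeasurable]
  rfl

theorem IsHeatMarkovChain.succ [IsProbabilityMeasure P]
    {X : Ω → Fin (N + 2) → UnitSphere d} (hX : IsHeatMarkovChain P t X) (ht : 0 < t) :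
    IsHeatMarkovChain P t fun ω (j : Fin (N + 1)) => X ω j.succ := by
  have hm : Measurable fun (x : Fin (N + 2) → UnitSphere d) (j : Fin (N + 1)) => x j.succ := by
    fun_prop
  have h := map_succ_chainMeasure (d := d) (N := N) ht
  rw [hX.heatMass_eq_one ht, one_smul] at h
  refine ⟨hm.comp_aemeasurable hX.aemeasurable, ?_⟩
  change _ = chainMeasure d t N
  rw [← h, ← show P.map X = chainMeasure d t (N + 1) from hX.map_eq,
    AEMeasurable.map_map_of_aemeasurable hm.aemeasurable hX.aemeasurable]
  rfl

/-- A block of consecutive terms of a heat Markov chain is a heat Markov chain. -/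
theorem IsHeatMarkovChain.block [IsProbabilityMeasure P] (ht : 0 < t)
    {X : Ω → ℕ → UnitSphere d} {K L a : ℕ} (haL : a + L ≤ K)
    (hX : IsHeatMarkovChain P t fun ω (j : Fin (K + 1)) => X ω j) :
    IsHeatMarkovChain P t fun ω (j : Fin (L + 1)) => X ω (a + j) := by
  -- Drop the first `a` points one at a time; the surplus at the end is removed afterwards.
  have h1 : ∀ (a L : ℕ), (IsHeatMarkovChain P t fun ω (j : Fin (a + L + 1)) => X ω j) →
      IsHeatMarkovChain P t fun ω (j : Fin (L + 1)) => X ω (a + j) := by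
    intro a
    induction a with
    | zero =>
      intro L h
      have e : 0 + L = L := zero_add L
      rw [e] at h
      simpa using h
    | succ a ih =>
      intro L h
      have e : a + 1 + L = a + (L + 1) := by omega
      rw [e] at h
      have h2 := (ih (L + 1) h).succ ht
      simpa only [Fin.val_succ, add_assoc, add_comm 1] using h2
  refine h1 a L ?_
  obtain ⟨r, rfl⟩ := Nat.exists_eq_add_of_le haL
  generalize a + L = K at hX
  induction r with
  | zero => exact hX
  | succ r ih => exact ih (by omega) (IsHeatMarkovChain.castSucc (N := K + r) hX ht)

end Chain

/-! ### The wave field as a measurable function of its boundary data. -/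

section Field

variable {d M N : ℕ}

/-- The value of a finite field at a pair of natural numbers, reduced modulo the side lengths. -/
def fieldAt (Y : Fin (M + 1) → Fin (N + 1) → UnitSphere d) (m n : ℕ) : UnitSphere d :=
  Y (Fin.ofNat (M + 1) m) (Fin.ofNat (N + 1) n)

theorem fieldAt_eq (Y : Fin (M + 1) → Fin (N + 1) → UnitSphere d) {m n : ℕ} (hm : m < M + 1)
    (hn : n < N + 1) : fieldAt Y m n = Y ⟨m, hm⟩ ⟨n, hn⟩ :=
  congrArg₂ Y (Fin.ext (Nat.mod_eq_of_lt hm)) (Fin.ext (Nat.mod_eq_of_lt hn))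

theorem IsDiscreteWaveMap.fieldAt_succ {Yp : Fin (M + 1) → UnitSphere d}
    {Ym : Fin (N + 1) → UnitSphere d} {Y : Fin (M + 1) → Fin (N + 1) → UnitSphere d}
    (h : IsDiscreteWaveMap Yp Ym Y) {m n : ℕ} (hm : m < M) (hn : n < N) :
    fieldAt Y (m + 1) (n + 1) =
      reflectMap (fieldAt Y (m + 1) n) (fieldAt Y m (n + 1)) (fieldAt Y m n) := by
  rw [fieldAt_eq Y (by omega) (by omega), fieldAt_eq Y (by omega) (by omega),
    fieldAt_eq Y (by omega) (by omega), fieldAt_eq Y (by omega) (by omega)]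
  exact Subtype.ext (h.equation ⟨m, hm⟩ ⟨n, hn⟩)

/-- The discrete wave map on `ℕ × ℕ` whose boundary data are read off a bi-infinite sequence: the
corner is `b N`, and `b` runs from `(0, N)` down to the corner and then to the right. -/
noncomputable def waveField (N : ℕ) (b : ℕ → UnitSphere d) : ℕ → ℕ → UnitSphere d
  | 0, n => b (N - n)
  | m + 1, 0 => b (N + (m + 1))
  | m + 1, n + 1 => reflectMap (waveField N b (m + 1) n) (waveField N b m (n + 1))
      (waveField N b m n)

theorem Measurable.waveField {α : Type*} [MeasurableSpace α] (N : ℕ) {b : α → ℕ → UnitSphere d}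
    (hb : ∀ j, Measurable fun a => b a j) (m n : ℕ) :
    Measurable fun a => waveField N (b a) m n := by
  induction m generalizing n with
  | zero => simpa only [_root_.waveField] using hb _
  | succ m ihm =>
    induction n with
    | zero => simpa only [_root_.waveField] using hb _
    | succ n ihn =>
      simp only [_root_.waveField]
      exact .reflectMap ihn (ihm _) (ihm _)

/-- The equation determines the field recursively. Truncated subtraction in `hb` covers both sides:
one of `i - N` and `N - i` is always 0. -/
theorem eq_waveField {M N : ℕ} {b : ℕ → UnitSphere d} {y : ℕ → ℕ → UnitSphere d}
    (hb : ∀ i ≤ M + N, b i = y (i - N) (N - i))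
    (hy : ∀ m < M, ∀ n < N, y (m + 1) (n + 1) = reflectMap (y (m + 1) n) (y m (n + 1)) (y m n))
    {m n : ℕ} (hm : m ≤ M) (hn : n ≤ N) : y m n = waveField N b m n := by
  induction m generalizing n with
  | zero =>
    rw [waveField, hb _ (by omega)]
    congr 1 <;> omega
  | succ m ihm =>
    induction n with
    | zero =>
      rw [waveField, hb _ (by omega)]
      congr 1 <;> omega
    | succ n ihn =>
      rw [waveField, hy m hm n hn, ihn (by omega), ihm (by omega) hn, ihm (by omega) (by omega)]

end Field

/-! ### Down-right paths and corner moves. -/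

section Path

variable {d M N : ℕ} {t : ℝ} {Ω : Type*} [MeasurableSpace Ω] {P : Measure Ω}

/-- The horizontal coordinate of a lattice path from `(0, N)` to `(M, 0)` with steps to the right
and down; the vertical coordinate after `j` steps is `N + m j - j`. -/
structure IsColumnPath (M N : ℕ) (m : ℕ → ℕ) : Prop where
  start : m 0 = 0
  finish : m (M + N) = M
  step : ∀ j < M + N, m (j + 1) = m j ∨ m (j + 1) = m j + 1

namespace IsColumnPath

variable {m : ℕ → ℕ}

theorem le_add (h : IsColumnPath M N m) {i j : ℕ} (hij : i ≤ j) (hj : j ≤ M + N) :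
    m i ≤ m j ∧ m j ≤ m i + (j - i) := by
  induction j, hij using Nat.le_induction with
  | base => simp
  | succ j hij ih =>
    have := h.step j (by omega)
    have := ih (by omega)
    omega

theorem bounds (h : IsColumnPath M N m) {j : ℕ} (hj : j ≤ M + N) :
    m j ≤ M ∧ m j ≤ j ∧ j ≤ N + m j := by
  have h1 := h.le_add (Nat.zero_le j) hj
  have h2 := h.le_add hj le_rfl
  have := h.start
  have := h.finish
  omega

/-- A path without a step to the right followed by a step down is the minimal one. -/
theorem eq_sub (h : IsColumnPath M N m)
    (hcorner : ∀ j, j + 2 ≤ M + N → m (j + 1) = m j + 1 → m (j + 2) ≠ m (j + 1))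
    {j : ℕ} (hj : j ≤ M + N) : m j = j - N := by
  -- After one step to the right, all later steps go right.
  have h1 : ∀ i k, i + k + 1 ≤ M + N → m (i + 1) = m i + 1 →
      m (i + k + 1) = m (i + k) + 1 ∧ m (i + k) = m i + k := by
    intro i k
    induction k with
    | zero => intro _ hi; simpa using hi
    | succ k ih =>
      intro hk hi
      have h2 := ih (by omega) hi
      have h3 := hcorner (i + k) (by omega) h2.1
      have h4 := h.step (i + k + 1) (by omega)
      rw [show i + (k + 1) = i + k + 1 by ring]
      refine ⟨h4.resolve_left h3, by omega⟩
  -- If all steps from time `i` on go right, ending in column `M` forces `i = N + m i`.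
  have h2 : ∀ i < M + N, m (i + 1) = m i + 1 → N ≤ i := by
    intro i hi h3
    have h4 := h1 i (M + N - i - 1) (by omega) h3
    rw [show i + (M + N - i - 1) + 1 = M + N by omega, h.finish] at h4
    omega
  have h3 : ∀ i ≤ N, m i = 0 := by
    intro i
    induction i with
    | zero => intro _; exact h.start
    | succ i ih =>
      intro hi
      have h4 := h.step i (by omega)
      have h5 := h2 i (by omega)
      have h6 := ih (by omega)
      omega
  by_cases hjN : j ≤ N
  · rw [h3 j hjN]; omega
  · have h4 := h.le_add (i := N) (j := j) (by omega) hj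
    have h5 := h.bounds hj
    have h6 := h3 N le_rfl
    omega

/-- A corner right-then-down becomes down-then-right: the path visits (m, n) in place of (m+1, n+1).
-/
theorem update (h : IsColumnPath M N m) {j : ℕ} (hj : j + 2 ≤ M + N) (h1 : m (j + 1) = m j + 1)
    (h2 : m (j + 2) = m (j + 1)) : IsColumnPath M N (Function.update m (j + 1) (m j)) where
  start := by simp [h.start]
  finish := by rw [Function.update_of_ne (by omega), h.finish]
  step i hi := by
    have := h.step i hi
    by_cases hi1 : i = j
    · subst hi1; simp
    · by_cases hi2 : i = j + 1
      · subst hi2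
        rw [Function.update_of_ne (by omega), Function.update_self, h2, h1]
        exact .inr rfl
      · rwa [Function.update_of_ne (by omega), Function.update_of_ne hi2]

end IsColumnPath

/-- Induction on the sum of the columns, which drops by 1 when a corner is pushed in. A path without
such a corner is the boundary path. -/
theorem isHeatMarkovChain_fieldAt (ht : 0 < t)
    {Yp : Ω → Fin (M + 1) → UnitSphere d} {Ym : Ω → Fin (N + 1) → UnitSphere d}
    {Y : Ω → Fin (M + 1) → Fin (N + 1) → UnitSphere d}
    (h_chain : IsHeatMarkovChain P t (fun ω => boundarySequence (Yp ω) (Ym ω)))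
    (hY : ∀ᵐ ω ∂P, IsDiscreteWaveMap (Yp ω) (Ym ω) (Y ω)) {m : ℕ → ℕ} (hm : IsColumnPath M N m) :
    IsHeatMarkovChain P t
      fun ω (j : Fin (M + N + 1)) => fieldAt (Y ω) (m j) (N + m j - j) := by
  induction hs : ∑ j ∈ Finset.range (M + N + 1), m j using Nat.strong_induction_on
    generalizing m with
  | _ s ih =>
  by_cases hcorner : ∀ j, j + 2 ≤ M + N → m (j + 1) = m j + 1 → m (j + 2) ≠ m (j + 1)
  · refine HasLaw.congr h_chain ?_
    filter_upwards [hY] with ω hω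
    ext1 j
    have hj : (j : ℕ) ≤ M + N := by omega
    have hmj := hm.eq_sub hcorner hj
    rw [fieldAt_eq _ (by omega) (by omega), boundarySequence]
    split_ifs with hjN
    · rw [← hω.boundary_minus]
      refine congrArg₂ (Y ω) (Fin.ext ?_) (Fin.ext ?_)
      · change m j = 0; omega
      · change N + m j - j = N - j; omega
    · rw [← hω.boundary_plus]
      refine congrArg₂ (Y ω) (Fin.ext hmj) (Fin.ext ?_)
      change N + m j - j = 0; omega
  · push Not at hcorner
    obtain ⟨j, hj, h1, h2⟩ := hcorner
    have hm' := hm.update hj h1 h2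
    have hlt : ∑ i ∈ Finset.range (M + N + 1), Function.update m (j + 1) (m j) i < s := by
      rw [← hs]
      refine Finset.sum_lt_sum (fun i _ => ?_) ⟨j + 1, by simp; omega, by simp [h1]⟩
      by_cases hi : i = j + 1
      · subst hi; simp [h1]
      · rw [Function.update_of_ne hi]
    -- Flipping the pushed-in corner restores the original path, by the wave maps equation.
    have hX := (ih _ hlt hm' rfl).flipAt ht (a := ⟨j, by omega⟩) (b := ⟨j + 1, by omega⟩) rfl
    refine HasLaw.congr hX ?_
    filter_upwards [hY] with ω hω
    have hb := hm.bounds (j := j + 2) hj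
    have hb0 := hm.bounds (j := j) (by omega)
    ext1 i
    by_cases hi : i = Fin.succ ⟨j, by omega⟩
    · subst hi
      simp only [flipAt, Function.update_self, Fin.val_succ, Fin.val_castSucc, h1]
      rw [Function.update_of_ne (by omega), Function.update_of_ne (by omega), reflectMap_comm, h2, h1]
      have h3 : N + (m j + 1) - (j + 1) = (N + m j - (j + 1)) + 1 := by omega
      have h4 : N + (m j + 1) - (j + 1 + 1) = N + m j - (j + 1) := by omega
      have h5 : N + m j - j = N + m j - (j + 1) + 1 := by omega
      rw [h3, h4, h5]
      exact hω.fieldAt_succ (by omega) (by omega)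
    · have hi' : (i : ℕ) ≠ j + 1 := fun h => hi (Fin.ext h)
      rw [flipAt, Function.update_of_ne hi, Function.update_of_ne hi']

/-- The boundary data of a translated subrectangle form a heat Markov chain. -/
theorem isHeatMarkovChain_subrectangle [IsProbabilityMeasure P] (ht : 0 < t)
    {Yp : Ω → Fin (M + 1) → UnitSphere d} {Ym : Ω → Fin (N + 1) → UnitSphere d}
    {Y : Ω → Fin (M + 1) → Fin (N + 1) → UnitSphere d}
    (h_chain : IsHeatMarkovChain P t (fun ω => boundarySequence (Yp ω) (Ym ω)))
    (hY : ∀ᵐ ω ∂P, IsDiscreteWaveMap (Yp ω) (Ym ω) (Y ω)) {m₀ n₀ M' N' : ℕ}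
    (hM : m₀ + M' ≤ M) (hN : n₀ + N' ≤ N) :
    IsHeatMarkovChain P t
      fun ω (i : Fin (M' + N' + 1)) => fieldAt (Y ω) (m₀ + (i - N')) (n₀ + (N' - i)) := by
  -- The path runs right to `(m₀, N)`, down to `(m₀, n₀)`, right to `(M, n₀)` and down to `(M, 0)`.
  -- The block wanted starts at `(m₀, n₀ + N')`.
  set m : ℕ → ℕ := fun j => min (min j m₀ + (j - (m₀ + N - n₀))) M with m_def
  have hm : IsColumnPath M N m := by
    refine ⟨by simp [m_def], ?_, fun j hj => ?_⟩ <;> simp only [m_def] <;> omega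
  have h := isHeatMarkovChain_fieldAt ht h_chain hY hm
  have hb := IsHeatMarkovChain.block ht (X := fun ω j => fieldAt (Y ω) (m j) (N + m j - j))
    (a := m₀ + (N - n₀ - N')) (L := M' + N') (by omega) h
  have heq : ∀ i < M' + N' + 1, ∀ ω, fieldAt (Y ω) (m₀ + (i - N')) (n₀ + (N' - i)) =
      fieldAt (Y ω) (m (m₀ + (N - n₀ - N') + i))
        (N + m (m₀ + (N - n₀ - N') + i) - (m₀ + (N - n₀ - N') + i)) := by
    intro i hi ω
    refine congrArg₂ (fieldAt (Y ω)) ?_ ?_ <;> simp only [m_def] <;> omega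
  simpa only [heq _ (Fin.is_lt _)] using hb

end Path

/-! ### The path property and translation invariance. -/

theorem lemma4 {d M N : ℕ} {t : ℝ} (ht : 0 < t)
    {Ω : Type*} [MeasurableSpace Ω] (P : Measure Ω) [IsProbabilityMeasure P]
    (Yp : Ω → Fin (M + 1) → UnitSphere d) (Ym : Ω → Fin (N + 1) → UnitSphere d)
    (Y : Ω → Fin (M + 1) → Fin (N + 1) → UnitSphere d)
    (h_zero : ∀ᵐ ω ∂P, Yp ω 0 = Ym ω 0)
    (h_chain : IsHeatMarkovChain P t (fun ω => boundarySequence (Yp ω) (Ym ω)))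
    (hY : ∀ᵐ ω ∂P, IsDiscreteWaveMap (Yp ω) (Ym ω) (Y ω)) :
    (∀ (m : Fin (M + N + 1) → Fin (M + 1)) (n : Fin (M + N + 1) → Fin (N + 1)),
      IsDownRightPath m n → IsHeatMarkovChain P t (fun ω j => Y ω (m j) (n j))) ∧
    (∀ (J m₀ n₀ : ℕ) (m n : Fin J → ℕ) (hm : ∀ j, m₀ + m j ≤ M) (hn : ∀ j, n₀ + n j ≤ N),
      IdentDistrib
        (fun ω j => Y ω ⟨m j, by have := hm j; omega⟩ ⟨n j, by have := hn j; omega⟩)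
        (fun ω j => Y ω ⟨m₀ + m j, by have := hm j; omega⟩ ⟨n₀ + n j, by have := hn j; omega⟩)
        P P) := by
  constructor
  · intro m n h
    set m' : ℕ → ℕ := fun j => m (Fin.ofNat (M + N + 1) j) with m'_def
    have hm' : ∀ j : Fin (M + N + 1), m' j = m j := fun j => by simp [m'_def]
    have hpath : IsColumnPath M N m' := by
      refine ⟨?_, ?_, fun j hj => ?_⟩
      · have := hm' 0
        simpa [h.start.1] using this
      · have := hm' (Fin.last (M + N))
        simpa [h.finish.1] using this
      · have h1 := hm' (Fin.castSucc ⟨j, hj⟩)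
        have h2 := hm' (Fin.succ ⟨j, hj⟩)
        simp only [Fin.val_castSucc, Fin.val_succ] at h1 h2
        rw [h1, h2]
        rcases h.step ⟨j, hj⟩ with h3 | h3
        · exact .inr h3.1
        · exact .inl (by rw [h3.1])
    -- Each step raises the difference of column and row by 1, so the column determines the row.
    have hn : ∀ j (hj : j < M + N + 1), (n ⟨j, hj⟩ : ℕ) = N + m' j - j := by
      intro j
      induction j with
      | zero =>
        intro hj
        have := hpath.start
        rw [show n ⟨0, hj⟩ = Fin.last N from h.start.2, this]
        simp
      | succ j ih =>
        intro hj
        have h1 := hm' ⟨j, by omega⟩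
        have h2 := hm' ⟨j + 1, hj⟩
        have h3 := ih (by omega)
        have h4 := (hpath.bounds (j := j) (by omega)).2.2
        rcases h.step ⟨j, by omega⟩ with h5 | h5
        · simp only [Fin.succ_mk, Fin.castSucc_mk] at h5 h1 h2
          rw [h5.2, h3]
          omega
        · simp only [Fin.succ_mk, Fin.castSucc_mk] at h5 h1 h2
          rw [h5.1] at h2
          omega
    have key := isHeatMarkovChain_fieldAt ht h_chain hY hpath
    convert key using 3 with ω j
    rw [fieldAt_eq _ (by rw [hm']; omega) (by rw [← hn j j.2]; omega)]
    exact congrArg₂ (Y ω) (Fin.ext (hm' j).symm) (Fin.ext (hn j j.2))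
  · intro J m₀ n₀ m n hm hn
    -- Only a nonempty index set guarantees `m₀ ≤ M` and `n₀ ≤ N`.
    rcases isEmpty_or_nonempty (Fin J) with hJ | ⟨⟨j₀⟩⟩
    · convert IdentDistrib.refl (μ := P) (f := fun (_ : Ω) (j : Fin J) => (hJ.elim j : UnitSphere d))
        aemeasurable_const using 1
    have hm₀ := hm j₀
    have hn₀ := hn j₀
    set M' := M - m₀
    set N' := N - n₀
    -- The same `G` reconstructs the field on both `M'` by `N'` rectangles, with corners `(0, 0)`
    -- and `(m₀, n₀)`, from boundary data of equal law.
    set G : (Fin (M' + N' + 1) → UnitSphere d) → Fin J → UnitSphere d := fun x j =>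
      waveField N' (fun i => x (Fin.ofNat (M' + N' + 1) i)) (m j) (n j)
    have hG : Measurable G := measurable_pi_iff.2 fun j =>
      Measurable.waveField (b := fun (x : Fin (M' + N' + 1) → UnitSphere d) (i : ℕ) =>
        x (Fin.ofNat (M' + N' + 1) i)) N' (fun i => measurable_pi_apply _) _ _
    have key : ∀ m₁ n₁ : ℕ, m₁ + M' ≤ M → n₁ + N' ≤ N →
        (fun ω => G fun i : Fin (M' + N' + 1) => fieldAt (Y ω) (m₁ + (i - N')) (n₁ + (N' - i)))
          =ᵐ[P] fun ω j => fieldAt (Y ω) (m₁ + m j) (n₁ + n j) := by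
      intro m₁ n₁ hm₁ hn₁
      filter_upwards [hY] with ω hω
      ext1 j
      have h1 := hm j
      have h2 := hn j
      refine (eq_waveField (M := M') (y := fun a b => fieldAt (Y ω) (m₁ + a) (n₁ + b))
        (fun i hi => ?_) (fun a ha b hb => ?_) (by omega) (by omega)).symm
      · simp only [Fin.val_ofNat, Nat.mod_eq_of_lt (Nat.lt_succ_of_le hi)]
      · exact hω.fieldAt_succ (m := m₁ + a) (n := n₁ + b) (by omega) (by omega)
    have c0 := isHeatMarkovChain_subrectangle (m₀ := 0) (n₀ := 0) (M' := M') (N' := N')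
      ht h_chain hY (by omega) (by omega)
    have c1 := isHeatMarkovChain_subrectangle (m₀ := m₀) (n₀ := n₀) (M' := M') (N' := N')
      ht h_chain hY (by omega) (by omega)
    have hid := (HasLaw.identDistrib c0 c1).comp hG
    have e0 := key 0 0 (by omega) (by omega)
    have e1 := key m₀ n₀ (by omega) (by omega)
    have := ((IdentDistrib.of_ae_eq hid.aemeasurable_fst e0).symm.trans hid).trans
      (IdentDistrib.of_ae_eq hid.aemeasurable_snd e1)
    convert this using 1
    · ext1 ω
      ext1 j
      have h1 := hm j
      have h2 := hn j
      simp only [zero_add]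
      rw [fieldAt_eq _ (by omega) (by omega)]
    · ext1 ω
      ext1 j
      rw [fieldAt_eq _ (Nat.lt_succ_of_le (hm j)) (Nat.lt_succ_of_le (hn j))]
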